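/- **Setting.** Values are integers, Booleans and constructors of user-declared algebraic datatypes applied to values. Terms are variables, constants, constructor applications, applications $g\,e_1\dots e_n$ of a named function, $\mathtt{if}\ e\ \mathtt{then}\ t_1\ \mathtt{else}\ t_2$, $\mathtt{match}\ e\ \mathtt{with}\ |_i\ C_i(\bar x_i)\mapsto t_i$, and applications of function terms $\mathtt{fix}\ f.\lambda x_1\dots\lambda x_n.t$; implementations of auxiliary functions may also use cost-free built-in operations on values and $\mathtt{tick}(c,t)$, which uses $c\in\mathbb N$ units of a resource and continues as $t$. Evaluation is the usual call-by-value small-step semantics on configurations $\langle t,C\rangle$, where $C$ is the resource usage so far. A signature of a function $g$ consists of an annotated type $\langle x_1{:}\{B_1\mid\varphi_1\}\to\dots\to x_n{:}\{B_n\mid\varphi_n\}\to\{B\mid\varphi\};\,O(\psi)\rangle$ with $\psi(u)=u^a\log^b u+c$, $a,b,c\ge0$, and a size function $\mathrm{size}_g$ from argument tuples to $\mathbb N$. An input is a tuple of values of the argument types. $T:\mathbb N\to\mathbb N$ is the *complexity function* of a function term $F$ with this signature if $F$ evaluates to a value on every input and, for all $u$, $T(u)$ is the supremum of the resource usages of $F$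 on the inputs of size $u$. We write $T\in O(\psi)$ if there are $c,M\ge0$ with $T(u)\le M\psi(u)$ for all $u\ge c$. An implementation of a signature is a function term whose outputs have the result type (with its refinement) and which has a complexity function that is in $O(\psi)$. A recurrence annotation $([c_1,\phi_1],\dots,[c_r,\phi_r];O(\psi))$ allows up to $c_k$ recursive calls on problems of size at most $\phi_k(u)$, $u$ being the size of the top-level problem. **The algorithm.** Given a goal signature $\langle\tau;O(\psi)\rangle$ with its size function, an environment $\Gamma$ (datatypes and signatures of auxiliary functions), a depth bound $d$ and a match bound $m$, the procedure chooses a name $f$, distinct parameters $\bar x$, and a body annotation $\alpha$ that the following table lists for the bound $\psi$: - $\log u$: $([1,\lfloor u/k\rfloor];O(1))$ with $k\ge2$; - $u\log u$: $([k,\lfloor u/k\rfloor];O(u))$ with $k\ge2$, or $([1,\lceil u/2\rceil],[1,\lfloor u/2\rfloor];O(u))$; - $u$: $([1,u-k];O(1))$ with $k\ge1$; - $u^2$: $([1,u-k];O(u))$ with $k\ge1$. It then outputs $\mathtt{fix}\ f.\lambda\bar x.t$ for a body $t$ returned by GenerateI on the goal $\langle\{B\mid\varphi\};\alpha\rangle$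 ($\{B\mid\varphi\}$ being the result type of $\tau$), in the environment extended with the parameters and $f$. GenerateI returns one of the following. 1. An E-term (variable, constant, or application of a constructor, an auxiliary function or $f$ to E-terms) of depth at most $d$ that passes CheckE (this is GenerateE). 2. If $m>0$, a $\mathtt{match}$ on a checked E-term $s$ of depth at most $d$ and some datatype, with one case per constructor with fresh variables. The cases are generated by GenerateI with match bound $m-1$, with the pattern variables and the path condition $s=C_i(\bar x_i)$ added to the environment, and with the recursive calls of $s$ subtracted from the costs in $\alpha$. 3. An $\mathtt{if}$ on a checked Boolean E-term $e$ of depth at most $d$. The branches are generated by GenerateI under the path conditions $e$ and $\neg e$, with the recursive calls of $e$ subtracted from the costs in $\alpha$. Checking an E-term computes its refinement type bottom-up. A variable, constant or constructor application is refined by equality with itself; an application of a function has the result refinement of its signature, with fresh variables (existentially quantified) for the arguments that satisfy the refinements of the arguments. Writing $\varphi_i$ for the refinements of the arguments of an application and $\bar y$ for values satisfying them, and quantifying over all instances of the environment, checking requires that: - the arguments of every application have subtypes of the declared argument types; - for every application of an auxiliary function $g$, $\bigwedge_i\varphi_i(y_i)\Rightarrow\psi_g(\mathrm{size}_g(\bar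 y))\in O(\psi_\alpha(\mathrm{size}_f(\bar x)))$, where $O(\psi_\alpha)$ is the bound in $\alpha$; that is, $\psi_g(\mathrm{size}_g(\bar y))\le M\,\psi_\alpha(\mathrm{size}_f(\bar x))$ whenever $\mathrm{size}_f(\bar x)\ge c$, with $c,M\ge0$ independent of the instance; - every recursive call can be matched to some $[c_k,\phi_k]$ with $\bigwedge_i\varphi_i(y_i)\Rightarrow\mathrm{size}_f(\bar y)\le\phi_k(\mathrm{size}_f(\bar x))$, where at most $c_k$ calls are matched to $[c_k,\phi_k]$. CheckE requires in addition that the computed refinement type be a subtype of the goal type. **Theorem (Soundness of the synthesis algorithm).** Let $\langle\tau;O(\psi)\rangle$ be a goal type with a size function, let $\Gamma$ be an environment, and let every auxiliary function of $\Gamma$ be implemented according to its signature. If the procedure can output the term $F=\mathtt{fix}\ f.\lambda x_1\dots\lambda x_n.t$ (for some bounds $d$, $m$, any order of enumeration and any sound validity checker), then the complexity of $F$ is bounded by $\psi$: if $T_F$ is the complexity function of $F$ on the inputs given by $\tau$, then $T_F\in O(\psi)$. -/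

import Mathlib

open scoped NNReal

namespace SynPlexity

/-! ## Values, terms and the concrete cost semantics -/

/-- Names of variables, functions, constructors and datatypes. -/
abbrev Sym := String

/-- Values: integers, Booleans and constructors applied to values. -/
inductive Val where
  | int (n : ℤ)
  | bool (b : Bool)
  | con (c : Sym) {n : ℕ} (args : Fin n → Val)

/-- Terms of the language, together with the forms that occur only in implementations of auxiliary
functions (`tick`, `prim`) or during evaluation (`app`).
* `call g e₁ … eₙ` is the application `g e₁ … eₙ` of a function name;
* `app f x̄ t ē` is the application `(fix f. λ x₁ … xₙ. t) ē` of a function term;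
* `mtch s ctor ar vars body` is `match s with |ᵢ Cᵢ (xᵢ¹ … xᵢⁿ) ↦ tᵢ`;
* `prim op ē` applies a built-in operation on values (such as `+`, `-`, `=`), free of cost. -/
inductive Term where
  | var (x : Sym)
  | lit (v : Val)
  | con (c : Sym) {n : ℕ} (args : Fin n → Term)
  | call (g : Sym) {n : ℕ} (args : Fin n → Term)
  | app (f : Sym) {n : ℕ} (params : Fin n → Sym) (body : Term) {m : ℕ} (args : Fin m → Term)
  | ite (guard thn els : Term)
  | mtch (s : Term) {n : ℕ} (ctor : Fin n → Sym) (ar : Fin n → ℕ)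
      (vars : (i : Fin n) → Fin (ar i) → Sym) (body : Fin n → Term)
  | prim {n : ℕ} (op : (Fin n → Val) → Val) (args : Fin n → Term)
  | tick (c : ℕ) (t : Term)

/-- A function term `fix name. λ params. body`. -/
structure FixTerm where
  name : Sym
  arity : ℕ
  params : Fin arity → Sym
  body : Term

/-- The term `F v₁ … vₙ`. -/
def FixTerm.applyTo (F : FixTerm) {n : ℕ} (vs : Fin n → Val) : Term :=
  .app F.name F.params F.body (fun i => .lit (vs i))

open Classical in
/-- The substitution `[v̄ / x̄]` (for pairwise distinct `x̄`). -/
noncomputable def bindVals {n : ℕ} (xs : Fin n → Sym) (vs : Fin n → Val) : Sym → Term :=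
  fun y => if h : ∃ i, xs i = y then .lit (vs h.choose) else .var y

open Classical in
/-- The substitution `σ` below a binder of the variables `x̄`. -/
noncomputable def hide {n : ℕ} (xs : Fin n → Sym) (σ : Sym → Term) : Sym → Term :=
  fun y => if ∃ i, xs i = y then .var y else σ y

/-- Substitution of (closed) terms for program variables. -/
noncomputable def Term.substV (σ : Sym → Term) : Term → Term
  | .var x => σ x
  | .lit v => .lit v
  | .con c args => .con c (fun i => (args i).substV σ)
  | .call g args => .call g (fun i => (args i).substV σ)
  | .app f xs b args => .app f xs (b.substV (hide xs σ)) (fun i => (args i).substV σ)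
  | .ite e t₁ t₂ => .ite (e.substV σ) (t₁.substV σ) (t₂.substV σ)
  | .mtch s ctor ar vars body =>
      .mtch (s.substV σ) ctor ar vars (fun i => (body i).substV (hide (vars i) σ))
  | .prim op args => .prim op (fun i => (args i).substV σ)
  | .tick c t => .tick c (t.substV σ)

/-- The substitution `[F / f]` of a function term `F = fix f. λ x̄. b` for its own name. -/
def Term.substF (F : FixTerm) : Term → Term
  | .var x => .var x
  | .lit v => .lit v
  | .con c args => .con c (fun i => (args i).substF F)
  | .call g args =>
      if g = F.name then .app F.name F.params F.body (fun i => (args i).substF F)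
      else .call g (fun i => (args i).substF F)
  | .app g ys t args =>
      .app g ys (if g = F.name then t else t.substF F) (fun i => (args i).substF F)
  | .ite e t₁ t₂ => .ite (e.substF F) (t₁.substF F) (t₂.substF F)
  | .mtch s ctor ar vars body =>
      .mtch (s.substF F) ctor ar vars (fun i => (body i).substF F)
  | .prim op args => .prim op (fun i => (args i).substF F)
  | .tick c t => .tick c (t.substF F)

/-- `t` is a value. -/
def Term.IsVal (t : Term) : Prop := ∃ v, t = .lit v

/-- One step `⟨t, C⟩ ↪ ⟨t', C'⟩` of the call-by-value cost semantics; arguments are evaluated from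
left to right.  `Δ` gives the implementations of the auxiliary functions. -/
inductive Step (Δ : Sym → Option FixTerm) : Term × ℕ → Term × ℕ → Prop
  | tick (c : ℕ) (t : Term) (C : ℕ) : Step Δ (.tick c t, C) (t, C + c)
  | app (f : Sym) {n : ℕ} (xs : Fin n → Sym) (b : Term) (vs : Fin n → Val) (C : ℕ) :
      Step Δ (.app f xs b (fun i => .lit (vs i)), C)
        ((b.substV (bindVals xs vs)).substF ⟨f, n, xs, b⟩, C)
  | appArg (f : Sym) {n : ℕ} (xs : Fin n → Sym) (b : Term) {m : ℕ} (args : Fin m → Term)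
      (i : Fin m) (t' : Term) (k C : ℕ) :
      (∀ j < i, (args j).IsVal) → Step Δ (args i, 0) (t', k) →
      Step Δ (.app f xs b args, C) (.app f xs b (Function.update args i t'), C + k)
  | call (g : Sym) (F : FixTerm) {m : ℕ} (args : Fin m → Term) (C : ℕ) :
      Δ g = some F → Step Δ (.call g args, C) (.app F.name F.params F.body args, C)
  | con (c : Sym) {n : ℕ} (vs : Fin n → Val) (C : ℕ) :
      Step Δ (.con c (fun i => .lit (vs i)), C) (.lit (.con c vs), C)
  | conArg (c : Sym) {n : ℕ} (args : Fin n → Term) (i : Fin n) (t' : Term) (k C : ℕ) :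
      (∀ j < i, (args j).IsVal) → Step Δ (args i, 0) (t', k) →
      Step Δ (.con c args, C) (.con c (Function.update args i t'), C + k)
  | prim {n : ℕ} (op : (Fin n → Val) → Val) (vs : Fin n → Val) (C : ℕ) :
      Step Δ (.prim op (fun i => .lit (vs i)), C) (.lit (op vs), C)
  | primArg {n : ℕ} (op : (Fin n → Val) → Val) (args : Fin n → Term) (i : Fin n) (t' : Term)
      (k C : ℕ) :
      (∀ j < i, (args j).IsVal) → Step Δ (args i, 0) (t', k) →
      Step Δ (.prim op args, C) (.prim op (Function.update args i t'), C + k)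
  | condTrue (t₁ t₂ : Term) (C : ℕ) : Step Δ (.ite (.lit (.bool true)) t₁ t₂, C) (t₁, C)
  | condFalse (t₁ t₂ : Term) (C : ℕ) : Step Δ (.ite (.lit (.bool false)) t₁ t₂, C) (t₂, C)
  | condGuard (e e' t₁ t₂ : Term) (k C : ℕ) :
      Step Δ (e, 0) (e', k) → Step Δ (.ite e t₁ t₂, C) (.ite e' t₁ t₂, C + k)
  | mtch {n : ℕ} (ctor : Fin n → Sym) (ar : Fin n → ℕ) (vars : (i : Fin n) → Fin (ar i) → Sym)
      (body : Fin n → Term) (i : Fin n) (vs : Fin (ar i) → Val) (C : ℕ) :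
      (∀ j < i, ctor j ≠ ctor i) →
      Step Δ (.mtch (.lit (.con (ctor i) vs)) ctor ar vars body, C)
        ((body i).substV (bindVals (vars i) vs), C)
  | mtchScrutinee (s s' : Term) {n : ℕ} (ctor : Fin n → Sym) (ar : Fin n → ℕ)
      (vars : (i : Fin n) → Fin (ar i) → Sym) (body : Fin n → Term) (k C : ℕ) :
      Step Δ (s, 0) (s', k) →
      Step Δ (.mtch s ctor ar vars body, C) (.mtch s' ctor ar vars body, C + k)

/-- `⟨t, 0⟩ ↪* ⟨v, C⟩`: the term `t` evaluates to the value `v` with resource usage `C`. -/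
def EvalsTo (Δ : Sym → Option FixTerm) (t : Term) (v : Val) (C : ℕ) : Prop :=
  Relation.ReflTransGen (Step Δ) (t, 0) (.lit v, C)

/-! ## Types

Logical expressions (refinements, path conditions, size functions, size expressions) are represented
by their denotations. -/

/-- Ordinary types. -/
inductive Base where
  | int
  | bool
  | data (D : Sym)

/-- Arguments `x₁ : {B₁ | φ₁}, …, xₙ : {Bₙ | φₙ}` of a function or constructor;
`ref i x̄ v` is `φᵢ`, a predicate of the inhabitant `v` that may mention `x̄`. -/
structure Args (n : ℕ) where
  base : Fin n → Base
  ref : Fin n → (Fin n → Val) → Val → Prop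

/-- User-defined algebraic datatypes: the constructors of every datatype and the types of their
arguments. -/
structure Decls where
  numCtors : Sym → ℕ
  ctor : (D : Sym) → Fin (numCtors D) → Sym
  arity : Sym → ℕ
  args : (c : Sym) → Args (arity c)

/-- `HasBase 𝒟 B v`: the value `v` is an inhabitant of the ordinary type `B`. -/
inductive HasBase (𝒟 : Decls) : Base → Val → Prop
  | int (n : ℤ) : HasBase 𝒟 .int (.int n)
  | bool (b : Bool) : HasBase 𝒟 .bool (.bool b)
  | con (D : Sym) (i : Fin (𝒟.numCtors D)) (vs : Fin (𝒟.arity (𝒟.ctor D i)) → Val) :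
      (∀ j, HasBase 𝒟 ((𝒟.args (𝒟.ctor D i)).base j) (vs j)) →
      (∀ j, (𝒟.args (𝒟.ctor D i)).ref j vs (vs j)) →
      HasBase 𝒟 (.data D) (.con (𝒟.ctor D i) vs)

/-- A bound expression `u ^ a * (log u) ^ b + c` with non-negative constants `a`, `b`, `c`. -/
structure BoundExpr where
  a : ℝ≥0
  b : ℝ≥0
  c : ℝ≥0

noncomputable def BoundExpr.eval (ψ : BoundExpr) (u : ℕ) : ℝ :=
  (u : ℝ) ^ (ψ.a : ℝ) * (Real.log u) ^ (ψ.b : ℝ) + ψ.c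

/-- An annotated function type `⟨x₁ : τ₁ → … → xₙ : τₙ → {cod | post}; O(bound)⟩` together with the
size function of the function. -/
structure FunSig where
  arity : ℕ
  args : Args arity
  cod : Base
  post : (Fin arity → Val) → Val → Prop
  size : (Fin arity → Val) → ℕ
  bound : BoundExpr

/-- `a` is a possible input of a function with signature `S`. -/
def FunSig.IsInput (𝒟 : Decls) (S : FunSig) (a : Fin S.arity → Val) : Prop :=
  ∀ i, HasBase 𝒟 (S.args.base i) (a i) ∧ S.args.ref i a (a i)

/-! ## Complexity -/

/-- `g ∈ O(ψ)`. -/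
def InBigO (g : ℕ → ℕ) (ψ : ℕ → ℝ) : Prop :=
  ∃ c : ℕ, ∃ M : ℝ, 0 ≤ M ∧ ∀ u ≥ c, (g u : ℝ) ≤ M * ψ u

/-- `T` is the complexity function of the function term `F` (with signature and size function `S`):
`F` evaluates to a value on every possible input, and `T u` is the supremum of the resource usages
of `F` on the inputs of size `u`. -/
def IsComplexity (𝒟 : Decls) (Δ : Sym → Option FixTerm) (F : FixTerm) (S : FunSig) (T : ℕ → ℕ) :
    Prop :=
  (∀ a, S.IsInput 𝒟 a → ∃ v C, EvalsTo Δ (F.applyTo a) v C) ∧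
  ∀ u, IsLUB {C | ∃ a v, S.IsInput 𝒟 a ∧ S.size a = u ∧ EvalsTo Δ (F.applyTo a) v C} (T u)

/-- `F` is an implementation of the auxiliary signature `S`: its outputs are of the declared type,
and its complexity is bounded by the declared bound. -/
def Implements (𝒟 : Decls) (Δ : Sym → Option FixTerm) (F : FixTerm) (S : FunSig) : Prop :=
  (∀ a v C, S.IsInput 𝒟 a → EvalsTo Δ (F.applyTo a) v C → HasBase 𝒟 S.cod v ∧ S.post a v) ∧
  ∃ T, IsComplexity 𝒟 Δ F S T ∧ InBigO T S.bound.eval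

/-! ## Environments and annotations -/

/-- Assignments of values to program variables. -/
abbrev Valuation := Sym → Val

/-- Refinements `φ(v)` over the program variables. -/
abbrev Refinement := Valuation → Val → Prop

/-- An entry of an environment: a variable binding `x : {B | φ}` or a path condition. -/
inductive Entry where
  | bind (x : Sym) (B : Base) (φ : Refinement)
  | path (φ : Valuation → Prop)

/-- The part of an environment that changes while a function body is synthesized. -/
abbrev Ctx := List Entry

/-- The part of an environment that is fixed while the body of a function is synthesized: datatypes,
signatures of auxiliary functions, the name `recFun` of the function, its signature, and the tuple
`params` of its arguments (called `args` in environments). -/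
structure Problem where
  decls : Decls
  aux : Sym → Option FunSig
  recFun : Sym
  sig : FunSig
  params : Fin sig.arity → Sym

/-- The signature of a function name in the scope of the function body. -/
def Problem.lookup (P : Problem) (g : Sym) : Option FunSig :=
  if g = P.recFun then some P.sig else P.aux g

/-- `ρ` is an instance of the environment `Γ`. -/
def Instance (𝒟 : Decls) (Γ : Ctx) (ρ : Valuation) : Prop :=
  ∀ e ∈ Γ, match e with
    | .bind x B φ => HasBase 𝒟 B (ρ x) ∧ φ ρ (ρ x)
    | .path φ => φ ρ

/-- The variables bound in `Γ` do not include `x`. -/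
def Fresh (Γ : Ctx) (x : Sym) : Prop := ∀ B φ, Entry.bind x B φ ∉ Γ

/-- The bindings `x₁ : {B₁ | φ₁}, …, xₙ : {Bₙ | φₙ}`. -/
def Args.bindings {n : ℕ} (A : Args n) (xs : Fin n → Sym) : Ctx :=
  List.ofFn fun i => Entry.bind (xs i) (A.base i) (fun ρ v => A.ref i (fun j => ρ (xs j)) v)

/-- A recurrence annotation `([c₁, φ₁], …, [cᵣ, φᵣ]; O(ψ))`: up to `cost k` recursive calls on
sub-problems of size at most `size k u`, where `u` is the size of the top-level problem. -/
structure Ann (r : ℕ) where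
  cost : Fin r → ℕ
  size : Fin r → ℕ → ℤ
  bound : BoundExpr

/-- The annotation that remains when `used k` calls of the `k`-th recursive-call cost are used. -/
def Ann.updateCost {r : ℕ} (α : Ann r) (used : Fin r → ℕ) : Ann r :=
  { α with cost := fun k => α.cost k - used k }

/-- The table of patterns: `Pattern B A` says that a function whose body has annotation `A` is given
the bound `B`.  Division on `ℕ` rounds down, and `⌈u / 2⌉ = (u + 1) / 2`. -/
inductive Pattern : BoundExpr → {r : ℕ} → Ann r → Prop
  /-- bound `log u` from `T(u) ≤ T(⌊u/d⌋) + O(1)` -/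
  | log (d : ℕ) : 2 ≤ d →
      Pattern ⟨0, 1, 0⟩ (r := 1) ⟨![1], ![fun u => ((u / d : ℕ) : ℤ)], ⟨0, 0, 0⟩⟩
  /-- bound `u log u` from `T(u) ≤ d T(⌊u/d⌋) + O(u)` -/
  | mulLog (d : ℕ) : 2 ≤ d →
      Pattern ⟨1, 1, 0⟩ (r := 1) ⟨![d], ![fun u => ((u / d : ℕ) : ℤ)], ⟨1, 0, 0⟩⟩
  /-- bound `u log u` from `T(u) ≤ T(⌈u/2⌉) + T(⌊u/2⌋) + O(u)` -/
  | halves :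
      Pattern ⟨1, 1, 0⟩ (r := 2)
        ⟨![1, 1], ![fun u => (((u + 1) / 2 : ℕ) : ℤ), fun u => ((u / 2 : ℕ) : ℤ)], ⟨1, 0, 0⟩⟩
  /-- bound `u` from `T(u) ≤ T(u - d) + O(1)` -/
  | linear (d : ℕ) : 1 ≤ d →
      Pattern ⟨1, 0, 0⟩ (r := 1) ⟨![1], ![fun u => (u : ℤ) - d], ⟨0, 0, 0⟩⟩
  /-- bound `u²` from `T(u) ≤ T(u - d) + O(u)` -/
  | quadratic (d : ℕ) : 1 ≤ d →
      Pattern ⟨2, 0, 0⟩ (r := 1) ⟨![1], ![fun u => (u : ℤ) - d], ⟨1, 0, 0⟩⟩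

/-! ## Checking E-terms -/

/-- In the instance `ρ`, the values `y₁, …, yₙ` have the types `{B₁ | φ₁}, …, {Bₙ | φₙ}`. -/
def Fits (𝒟 : Decls) {n : ℕ} (B : Fin n → Base) (φ : Fin n → Refinement) (ρ : Valuation)
    (y : Fin n → Val) : Prop :=
  ∀ i, HasBase 𝒟 (B i) (y i) ∧ φ i ρ (y i)

/-- `Γ ⊢ {Bᵢ | φᵢ} <: τᵢ` for all arguments, where the (possibly dependent) `τᵢ` are given
by `A`. -/
def ArgsOk (𝒟 : Decls) (Γ : Ctx) {n : ℕ} (A : Args n) (φ : Fin n → Refinement) : Prop :=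
  ∀ ρ y, Instance 𝒟 Γ ρ → Fits 𝒟 A.base φ ρ y → ∀ i, A.ref i y (y i)

/-- The refinement of an application of a function with signature `S` to arguments with refinements
`φᵢ`; the existentially quantified `z` are the fresh variables that stand for the arguments. -/
def appRef (𝒟 : Decls) (S : FunSig) (φ : Fin S.arity → Refinement) : Refinement :=
  fun ρ v => ∃ z, Fits 𝒟 S.args.base φ ρ z ∧ S.post z v

/-- The size of the top-level problem in the instance `ρ`. -/
def Problem.topSize (P : Problem) (ρ : Valuation) : ℕ :=
  P.sig.size (fun i => ρ (P.params i))

/-- `Γ ⊨ ⋀ᵢ [yᵢ/v]φᵢ ⇒ [size_g ȳ / u]ψ_g ∈ O([size args / u]ψ)`, as an `∃∀` query. -/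
def AuxCostOk (P : Problem) (Γ : Ctx) (S : FunSig) (φ : Fin S.arity → Refinement)
    (ψ : BoundExpr) : Prop :=
  ∃ c : ℕ, ∃ M : ℝ, 0 ≤ M ∧ ∀ ρ y, Instance P.decls Γ ρ → Fits P.decls S.args.base φ ρ y →
    c ≤ P.topSize ρ → S.bound.eval (S.size y) ≤ M * ψ.eval (P.topSize ρ)

/-- `Γ ⊨ ⋀ᵢ [yᵢ/v]φᵢ ⇒ size ȳ ≤ [size args / u]φ`, for the size expression `φ`. -/
def RecSizeOk (P : Problem) (Γ : Ctx) (φ : Fin P.sig.arity → Refinement) (sz : ℕ → ℤ) : Prop :=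
  ∀ ρ y, Instance P.decls Γ ρ → Fits P.decls P.sig.args.base φ ρ y →
    (P.sig.size y : ℤ) ≤ sz (P.topSize ρ)

/-- `EnumerateE P Γ d B t`: `t` is an E-term of ordinary type `B` over `Γ`, of depth at most `d`. -/
inductive EnumerateE (P : Problem) (Γ : Ctx) : ℕ → Base → Term → Prop
  | var {d : ℕ} {x : Sym} {B : Base} {φ : Refinement} :
      Entry.bind x B φ ∈ Γ → EnumerateE P Γ d B (.var x)
  | int {d : ℕ} (n : ℤ) : EnumerateE P Γ d .int (.lit (.int n))
  | bool {d : ℕ} (b : Bool) : EnumerateE P Γ d .bool (.lit (.bool b))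
  | con {d : ℕ} {D : Sym} (i : Fin (P.decls.numCtors D))
      {args : Fin (P.decls.arity (P.decls.ctor D i)) → Term} :
      (∀ j, EnumerateE P Γ d ((P.decls.args (P.decls.ctor D i)).base j) (args j)) →
      EnumerateE P Γ (d + 1) (.data D) (.con (P.decls.ctor D i) args)
  | call {d : ℕ} {g : Sym} {S : FunSig} {args : Fin S.arity → Term} :
      P.lookup g = some S → (∀ i, EnumerateE P Γ d (S.args.base i) (args i)) →
      EnumerateE P Γ (d + 1) S.cod (.call g args)

/-- `InferE P Γ α t B φ used`: all checks on the E-term `t` with respect to the annotation `α`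
succeed, `t` has the refinement type `{B | φ}`, and (for some matching of the recursive calls in `t`
to recursive-call costs they are consistent with) `used k` recursive calls are matched to the
`k`-th recursive-call cost of `α`. -/
inductive InferE (P : Problem) (Γ : Ctx) {r : ℕ} (α : Ann r) :
    Term → Base → Refinement → (Fin r → ℕ) → Prop
  | var {x : Sym} {B : Base} {φ : Refinement} :
      Entry.bind x B φ ∈ Γ → InferE P Γ α (.var x) B (fun ρ v => φ ρ v ∧ v = ρ x) 0
  | int (n : ℤ) : InferE P Γ α (.lit (.int n)) .int (fun _ v => v = .int n) 0
  | bool (b : Bool) : InferE P Γ α (.lit (.bool b)) .bool (fun _ v => v = .bool b) 0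
  | con {D : Sym} (i : Fin (P.decls.numCtors D))
      {args : Fin (P.decls.arity (P.decls.ctor D i)) → Term}
      {φ : Fin (P.decls.arity (P.decls.ctor D i)) → Refinement}
      {used : Fin (P.decls.arity (P.decls.ctor D i)) → Fin r → ℕ} :
      (∀ j, InferE P Γ α (args j) ((P.decls.args (P.decls.ctor D i)).base j) (φ j) (used j)) →
      ArgsOk P.decls Γ (P.decls.args (P.decls.ctor D i)) φ →
      InferE P Γ α (.con (P.decls.ctor D i) args) (.data D)
        (fun ρ v => ∃ z, Fits P.decls (P.decls.args (P.decls.ctor D i)).base φ ρ z ∧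
          v = .con (P.decls.ctor D i) z)
        (∑ j, used j)
  /-- application of an auxiliary function -/
  | app {g : Sym} {S : FunSig} {args : Fin S.arity → Term} {φ : Fin S.arity → Refinement}
      {used : Fin S.arity → Fin r → ℕ} :
      g ≠ P.recFun → P.aux g = some S →
      (∀ i, InferE P Γ α (args i) (S.args.base i) (φ i) (used i)) →
      ArgsOk P.decls Γ S.args φ →
      AuxCostOk P Γ S φ α.bound →
      InferE P Γ α (.call g args) S.cod (appRef P.decls S φ) (∑ i, used i)
  /-- recursive call, matched to the `k`-th recursive-call cost -/
  | recApp {args : Fin P.sig.arity → Term} {φ : Fin P.sig.arity → Refinement}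
      {used : Fin P.sig.arity → Fin r → ℕ} (k : Fin r) :
      (∀ i, InferE P Γ α (args i) (P.sig.args.base i) (φ i) (used i)) →
      ArgsOk P.decls Γ P.sig.args φ →
      RecSizeOk P Γ φ (α.size k) →
      InferE P Γ α (.call P.recFun args) P.sig.cod (appRef P.decls P.sig φ)
        ((∑ i, used i) + Pi.single k 1)

/-- `CheckE(t, Γ, ⟨{B | goal}; α⟩)`: the checks on `t` succeed, its recursive calls do not exceed the
recursive-call costs of `α`, and its refinement type is a subtype of the goal type. -/
def CheckE (P : Problem) (Γ : Ctx) {r : ℕ} (α : Ann r) (B : Base) (goal : Refinement) (t : Term) :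
    Prop :=
  ∃ φ used, InferE P Γ α t B φ used ∧ (∀ k, used k ≤ α.cost k) ∧
    ∀ ρ v, Instance P.decls Γ ρ → HasBase P.decls B v → φ ρ v → goal ρ v

/-! ## The synthesis algorithm

The relations below hold for the terms that the procedures can return, for any order of enumeration
and with any (sound) procedure for deciding validity. -/

/-- `GenerateE(Γ, ⟨{B | goal}; α⟩, d)` can return `t`. -/
def GenerateE (P : Problem) (Γ : Ctx) {r : ℕ} (α : Ann r) (B : Base) (goal : Refinement) (d : ℕ)
    (t : Term) : Prop :=
  EnumerateE P Γ d B t ∧ CheckE P Γ α B goal t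

/-- The environment in which the case `c x̄ ↦ _` is synthesized, for a scrutinee with
refinement `φ`: it binds `x̄` and contains the path condition that the scrutinee equals `c x̄`. -/
def matchCtx (𝒟 : Decls) (Γ : Ctx) (φ : Refinement) (c : Sym) (xs : Fin (𝒟.arity c) → Sym) : Ctx :=
  .path (fun ρ => φ ρ (.con c (fun j => ρ (xs j)))) :: ((𝒟.args c).bindings xs ++ Γ)

/-- `GenerateI(Γ, ⟨{B | goal}; α⟩, d, m)` can return `t`. -/
inductive GenerateI (P : Problem) (B : Base) (goal : Refinement) (d : ℕ) {r : ℕ} :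
    Ctx → Ann r → ℕ → Term → Prop
  | eterm {Γ : Ctx} {α : Ann r} {m : ℕ} {t : Term} :
      GenerateE P Γ α B goal d t → GenerateI P B goal d Γ α m t
  /-- a `match` on an E-term `s`, with one case for every constructor of its datatype -/
  | mtch {Γ : Ctx} {α : Ann r} {m : ℕ} {D : Sym} {s : Term} {φ : Refinement} {used : Fin r → ℕ}
      {vars : (i : Fin (P.decls.numCtors D)) → Fin (P.decls.arity (P.decls.ctor D i)) → Sym}
      {body : Fin (P.decls.numCtors D) → Term} :
      EnumerateE P Γ d (.data D) s →
      InferE P Γ α s (.data D) φ used → (∀ k, used k ≤ α.cost k) →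
      (∀ i, Function.Injective (vars i)) → (∀ i j, Fresh Γ (vars i j)) →
      (∀ i, GenerateI P B goal d (matchCtx P.decls Γ φ (P.decls.ctor D i) (vars i))
        (α.updateCost used) m (body i)) →
      GenerateI P B goal d Γ α (m + 1)
        (.mtch s (P.decls.ctor D) (fun i => P.decls.arity (P.decls.ctor D i)) vars body)
  /-- an `if` on an E-term; the refinement `φ` of the guard gives the path condition
  `[true/v]φ` of the first branch and `[false/v]φ` of the second one -/
  | ite {Γ : Ctx} {α : Ann r} {m : ℕ} {cond t₁ t₂ : Term} {φ : Refinement} {used : Fin r → ℕ} :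
      EnumerateE P Γ d .bool cond →
      InferE P Γ α cond .bool φ used → (∀ k, used k ≤ α.cost k) →
      GenerateI P B goal d (.path (fun ρ => φ ρ (.bool true)) :: Γ) (α.updateCost used) m t₁ →
      GenerateI P B goal d (.path (fun ρ => φ ρ (.bool false)) :: Γ) (α.updateCost used) m t₂ →
      GenerateI P B goal d Γ α m (.ite cond t₁ t₂)

/-- `Synthesizes 𝒟 aux S d m F`: from the goal type (and size function) `S` and the environment
given by the datatypes `𝒟` and the auxiliary signatures `aux`, the algorithm with depth bound `d` and
match bound `m` can output the function term `F`.  The algorithm finds a pattern `α` for the bound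
of the goal, and synthesizes the body for the goal `⟨{cod | post}; α⟩`. -/
inductive Synthesizes (𝒟 : Decls) (aux : Sym → Option FunSig) (S : FunSig) (d m : ℕ) :
    FixTerm → Prop
  | abs (f : Sym) (xs : Fin S.arity → Sym) (t : Term) {r : ℕ} (α : Ann r) :
      Function.Injective xs →
      Pattern S.bound α →
      GenerateI ⟨𝒟, aux, f, S, xs⟩ S.cod (fun ρ v => S.post (fun i => ρ (xs i)) v) d
        (S.args.bindings xs) α m t →
      Synthesizes 𝒟 aux S d m ⟨f, S.arity, xs, t⟩

end SynPlexity

/-!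
The body of the synthesized function contains no ticks, so all of its cost comes from calls of
auxiliary functions and of the function itself.  The checks bound the former by `O(ψ_α)` and the
number and problem sizes of the latter by the annotation `α`; hence the complexity function `T`
satisfies the recurrence `T u ≤ M * ψ_α u + ∑ k, cost k * max {T w | w ≤ size k u}` for large `u`
(`GenerateI.recurrence`), and each row of the table of patterns solves its recurrence
(`Pattern.inBigO`).

The checks speak about refinements, so they say something about actual evaluations only if the
values of E-terms satisfy the inferred refinements.  Types and costs are therefore treated together,
in `InferE.soundTerm` and `GenerateI.soundTerm`, along the syntax of the body, with constants `c` and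
`M` that do not depend on the input.  The refinement of a recursive call relies on the type
correctness of the function that is being checked, which is obtained by induction on the number of
evaluation steps; for this, evaluations are counted in steps (`EvalIn`), and an evaluation of
a compound term is decomposed into shorter evaluations of its parts.  Recursive calls in the body are
evaluated after the function term has been substituted; as this term is closed, the pattern variables
of an enclosing `match` do not affect it (`Scoped.substV_case`).

For a function with complexity function `T`, termination on all inputs and finiteness of `T u` are
given, so small problem sizes enter the solution of the recurrences only as additive constants.
-/

namespace SynPlexity

/-! ### Evaluations with a step count -/

/-- `EvalIn Δ n t v C`: the term `t` evaluates to `v` in exactly `n` steps, with resource usage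
`C`. -/
inductive EvalIn (Δ : Sym → Option FixTerm) : ℕ → Term → Val → ℕ → Prop
  | lit (v : Val) : EvalIn Δ 0 (.lit v) v 0
  | step {n : ℕ} {t t' : Term} {v : Val} {k C : ℕ} :
      Step Δ (t, 0) (t', k) → EvalIn Δ n t' v C → EvalIn Δ (n + 1) t v (k + C)

theorem Step.shift {Δ : Sym → Option FixTerm} {t t' : Term} {C C' : ℕ}
    (h : Step Δ (t, C) (t', C')) (D : ℕ) : ∃ k, C' = C + k ∧ Step Δ (t, D) (t', D + k) := by
  cases h
  case tick c => exact ⟨c, rfl, .tick _ _ _⟩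
  case app => exact ⟨0, rfl, .app _ _ _ _ _⟩
  case appArg k h₁ h₂ => exact ⟨k, rfl, .appArg _ _ _ _ _ _ _ _ h₁ h₂⟩
  case call h => exact ⟨0, rfl, .call _ _ _ _ h⟩
  case con => exact ⟨0, rfl, .con _ _ _⟩
  case conArg k h₁ h₂ => exact ⟨k, rfl, .conArg _ _ _ _ _ _ h₁ h₂⟩
  case prim => exact ⟨0, rfl, .prim _ _ _⟩
  case primArg k h₁ h₂ => exact ⟨k, rfl, .primArg _ _ _ _ _ _ h₁ h₂⟩
  case condTrue => exact ⟨0, rfl, .condTrue _ _ _⟩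
  case condFalse => exact ⟨0, rfl, .condFalse _ _ _⟩
  case condGuard k h => exact ⟨k, rfl, .condGuard _ _ _ _ _ _ h⟩
  case mtch h => exact ⟨0, rfl, .mtch _ _ _ _ _ _ _ h⟩
  case mtchScrutinee k h => exact ⟨k, rfl, .mtchScrutinee _ _ _ _ _ _ _ _ h⟩

theorem EvalIn.reflTransGen {Δ : Sym → Option FixTerm} {n : ℕ} {t : Term} {v : Val} {C : ℕ}
    (h : EvalIn Δ n t v C) (D : ℕ) :
    Relation.ReflTransGen (Step Δ) (t, D) (.lit v, D + C) := by
  induction h generalizing D with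
  | lit v => exact .refl
  | step hs _ ih =>
    obtain ⟨k', hk, hs'⟩ := hs.shift D
    obtain rfl : _ = k' := by simpa using hk
    rw [← add_assoc]
    exact .head hs' (ih _)

theorem EvalIn.evalsTo {Δ : Sym → Option FixTerm} {n : ℕ} {t : Term} {v : Val} {C : ℕ}
    (h : EvalIn Δ n t v C) : EvalsTo Δ t v C := by
  simpa [EvalsTo] using h.reflTransGen 0

theorem EvalsTo.exists_evalIn {Δ : Sym → Option FixTerm} {t : Term} {v : Val} {C : ℕ}
    (h : EvalsTo Δ t v C) : ∃ n, EvalIn Δ n t v C := by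
  have key : ∀ p : Term × ℕ, Relation.ReflTransGen (Step Δ) p (.lit v, C) →
      ∃ n k, C = p.2 + k ∧ EvalIn Δ n p.1 v k := by
    intro p hp
    induction hp using Relation.ReflTransGen.head_induction_on with
    | refl => exact ⟨0, 0, rfl, .lit v⟩
    | @head p q hs _ ih =>
      obtain ⟨n, k, hC, hn⟩ := ih
      obtain ⟨t, D⟩ := p
      obtain ⟨t', D'⟩ := q
      obtain ⟨j, hj, hs'⟩ := hs.shift 0
      rw [zero_add] at hs'
      exact ⟨n + 1, j + k, by simp only at hC ⊢; omega, .step hs' hn⟩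
  obtain ⟨n, k, hC, hn⟩ := key _ h
  obtain rfl : C = k := by simpa using hC
  exact ⟨n, hn⟩

theorem Step.lit_irreducible {Δ : Sym → Option FixTerm} {v : Val} {C : ℕ} {p : Term × ℕ} :
    ¬ Step Δ (.lit v, C) p := by
  intro h; cases h

theorem EvalIn.of_lit {Δ : Sym → Option FixTerm} {n : ℕ} {v w : Val} {C : ℕ}
    (h : EvalIn Δ n (.lit v) w C) : w = v ∧ C = 0 := by
  cases h with
  | lit => exact ⟨rfl, rfl⟩
  | step hs _ => exact (Step.lit_irreducible hs).elim

/-- Decomposition of an evaluation of a term with argument positions: if a step of `K args` is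
a step of one of the arguments unless all of them are values, then every argument is evaluated, and
what remains is an evaluation of `K` on the resulting values. -/
theorem EvalIn.decompose {Δ : Sym → Option FixTerm} {m : ℕ} (K : (Fin m → Term) → Term)
    (hK : ∀ args v, K args ≠ .lit v)
    (hstep : ∀ args t' k, Step Δ (K args, 0) (t', k) →
      (∃ i t'', Step Δ (args i, 0) (t'', k) ∧ t' = K (Function.update args i t'')) ∨
        ∃ vs : Fin m → Val, args = fun i => .lit (vs i))
    {n : ℕ} {args : Fin m → Term} {v : Val} {C : ℕ} (h : EvalIn Δ n (K args) v C) :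
    ∃ (vs : Fin m → Val) (ns Cs : Fin m → ℕ) (n' C' : ℕ),
      (∀ i, EvalIn Δ (ns i) (args i) (vs i) (Cs i)) ∧ (∀ i, ns i < n) ∧
      EvalIn Δ n' (K fun i => .lit (vs i)) v C' ∧ n' ≤ n ∧ C = ∑ i, Cs i + C' := by
  induction n generalizing args C with
  | zero =>
    generalize ht : K args = t at h
    cases h
    exact (hK _ _ ht).elim
  | succ n ih =>
    generalize ht : K args = t at h
    cases h with
    | @step _ _ t' _ k C₀ hs h' =>
      subst ht
      rcases hstep _ _ _ hs with ⟨i, t'', hi, rfl⟩ | ⟨vs, rfl⟩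
      · obtain ⟨vs, ns, Cs, n', C', h₁, h₂, h₃, h₄, rfl⟩ := ih h'
        refine ⟨vs, Function.update ns i (ns i + 1), Function.update Cs i (k + Cs i), n', C',
          fun j => ?_, fun j => ?_, h₃, by omega, ?_⟩
        · rcases eq_or_ne j i with rfl | hj
          · have := h₁ j
            simp only [Function.update_self] at this ⊢
            exact .step hi this
          · simpa [Function.update_of_ne hj] using h₁ j
        · rcases eq_or_ne j i with rfl | hj
          · simpa using h₂ j
          · simpa [Function.update_of_ne hj] using (h₂ j).trans (Nat.lt_succ_self n)
        · rw [Finset.sum_update_of_mem (Finset.mem_univ i),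
            ← Finset.add_sum_erase _ Cs (Finset.mem_univ i), Finset.sdiff_singleton_eq_erase]
          ring
      · exact ⟨vs, 0, 0, n + 1, k + C₀, fun i => .lit _, fun i => Nat.succ_pos n, .step hs h',
          le_rfl, by simp⟩

theorem EvalIn.con_inv {Δ : Sym → Option FixTerm} {n m : ℕ} {c : Sym} {args : Fin m → Term}
    {v : Val} {C : ℕ} (h : EvalIn Δ n (.con c args) v C) :
    ∃ (vs : Fin m → Val) (ns Cs : Fin m → ℕ), v = .con c vs ∧
      (∀ i, EvalIn Δ (ns i) (args i) (vs i) (Cs i)) ∧ (∀ i, ns i < n) ∧ C = ∑ i, Cs i := by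
  obtain ⟨vs, ns, Cs, n', C', h₁, h₂, h₃, -, rfl⟩ :=
    EvalIn.decompose (Term.con c) (fun _ _ => by simp) (fun args t' k hs => by
      generalize ht : Term.con c args = t at hs
      cases hs
      case con => cases ht; exact .inr ⟨_, rfl⟩
      case conArg i t'' k _ hi => cases ht; exact .inl ⟨i, t'', by simpa using hi, rfl⟩
      all_goals cases ht) h
  suffices v = .con c vs ∧ C' = 0 from ⟨vs, ns, Cs, this.1, h₁, h₂, by simp [this.2]⟩
  generalize ht : (Term.con c fun i => .lit (vs i)) = t at h₃
  cases h₃ with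
  | lit => cases ht
  | step hs h' =>
    cases hs
    case con vs' =>
      simp only [Term.con.injEq] at ht
      obtain ⟨rfl, rfl, ht⟩ := ht
      obtain rfl : vs = vs' := by
        funext i
        simpa using congrFun (eq_of_heq ht) i
      obtain ⟨rfl, rfl⟩ := h'.of_lit
      exact ⟨rfl, rfl⟩
    case conArg i t'' k _ hi =>
      cases ht
      exact (Step.lit_irreducible hi).elim
    all_goals cases ht

theorem EvalIn.app_inv {Δ : Sym → Option FixTerm} {n m l : ℕ} {f : Sym} {xs : Fin l → Sym}
    {b : Term} {args : Fin m → Term} {v : Val} {C : ℕ} (h : EvalIn Δ n (.app f xs b args) v C) :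
    ∃ (vs : Fin m → Val) (ns Cs : Fin m → ℕ) (n' C' : ℕ),
      (∀ i, EvalIn Δ (ns i) (args i) (vs i) (Cs i)) ∧ (∀ i, ns i < n) ∧
      EvalIn Δ n' (.app f xs b fun i => .lit (vs i)) v C' ∧ n' ≤ n ∧ C = ∑ i, Cs i + C' :=
  EvalIn.decompose (Term.app f xs b) (fun _ _ => by simp) (fun args t' k hs => by
    generalize ht : Term.app f xs b args = t at hs
    cases hs
    case app => cases ht; exact .inr ⟨_, rfl⟩
    case appArg i t'' k _ hi => cases ht; exact .inl ⟨i, t'', by simpa using hi, rfl⟩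
    all_goals cases ht) h

theorem EvalIn.app_lit_inv {Δ : Sym → Option FixTerm} {n m : ℕ} {f : Sym} {xs : Fin m → Sym}
    {b : Term} {vs : Fin m → Val} {v : Val} {C : ℕ}
    (h : EvalIn Δ n (.app f xs b fun i => .lit (vs i)) v C) :
    ∃ n' < n, EvalIn Δ n' ((b.substV (bindVals xs vs)).substF ⟨f, m, xs, b⟩) v C := by
  generalize ht : (Term.app f xs b fun i => .lit (vs i)) = t at h
  cases h with
  | lit => cases ht
  | step hs h' =>
    cases hs
    case app vs' =>
      simp only [Term.app.injEq] at ht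
      obtain ⟨rfl, rfl, hxs, rfl, -, ht⟩ := ht
      obtain rfl := eq_of_heq hxs
      obtain rfl : vs = vs' := by
        funext i
        simpa using congrFun (eq_of_heq ht) i
      exact ⟨_, Nat.lt_succ_self _, by simpa using h'⟩
    case appArg i t'' k _ hi =>
      cases ht
      exact (Step.lit_irreducible hi).elim
    all_goals cases ht

theorem EvalIn.call_inv {Δ : Sym → Option FixTerm} {n m : ℕ} {g : Sym} {G : FixTerm}
    (hG : Δ g = some G) {args : Fin m → Term} {v : Val} {C : ℕ}
    (h : EvalIn Δ n (.call g args) v C) :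
    ∃ n' < n, EvalIn Δ n' (.app G.name G.params G.body args) v C := by
  cases h with
  | step hs h' =>
    cases hs with
    | call _ G' _ _ hG' =>
      obtain rfl : G = G' := by simpa [hG] using hG'
      exact ⟨_, Nat.lt_succ_self _, by simpa using h'⟩

theorem EvalIn.ite_inv {Δ : Sym → Option FixTerm} {n : ℕ} {e t₁ t₂ : Term} {v : Val} {C : ℕ}
    (h : EvalIn Δ n (.ite e t₁ t₂) v C) :
    ∃ (b : Bool) (n₁ n₂ C₁ C₂ : ℕ), EvalIn Δ n₁ e (.bool b) C₁ ∧
      EvalIn Δ n₂ (if b then t₁ else t₂) v C₂ ∧ n₁ < n ∧ n₂ < n ∧ C = C₁ + C₂ := by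
  induction n generalizing e C with
  | zero => cases h
  | succ n ih =>
    cases h with
    | step hs h' =>
      cases hs with
      | condTrue => exact ⟨true, 0, n, 0, _, .lit _, by simpa using h', by omega, by omega, rfl⟩
      | condFalse => exact ⟨false, 0, n, 0, _, .lit _, by simpa using h', by omega, by omega, rfl⟩
      | condGuard _ e' _ _ k _ hs =>
        obtain ⟨b, n₁, n₂, C₁, C₂, h₁, h₂, h₃, h₄, rfl⟩ := ih h'
        exact ⟨b, n₁ + 1, n₂, k + C₁, C₂, .step hs h₁, h₂, by omega, by omega, by omega⟩

theorem EvalIn.mtch_inv {Δ : Sym → Option FixTerm} {n m : ℕ} {s : Term} {ctor : Fin m → Sym}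
    {ar : Fin m → ℕ} {vars : (i : Fin m) → Fin (ar i) → Sym} {body : Fin m → Term} {v : Val}
    {C : ℕ} (h : EvalIn Δ n (.mtch s ctor ar vars body) v C) :
    ∃ (i : Fin m) (vs : Fin (ar i) → Val) (n₁ n₂ C₁ C₂ : ℕ),
      EvalIn Δ n₁ s (.con (ctor i) vs) C₁ ∧
      EvalIn Δ n₂ ((body i).substV (bindVals (vars i) vs)) v C₂ ∧ n₁ < n ∧ n₂ < n ∧
      C = C₁ + C₂ := by
  induction n generalizing s C with
  | zero => cases h
  | succ n ih =>
    cases h with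
    | step hs h' =>
      cases hs with
      | mtch _ _ _ _ i vs =>
        exact ⟨i, vs, 0, n, 0, _, .lit _, h', by omega, by omega, rfl⟩
      | mtchScrutinee _ s' _ _ _ _ k _ hs =>
        obtain ⟨i, vs, n₁, n₂, C₁, C₂, h₁, h₂, h₃, h₄, rfl⟩ := ih h'
        exact ⟨i, vs, n₁ + 1, n₂, k + C₁, C₂, .step hs h₁, h₂, by omega, by omega, by omega⟩

/-! ### Scoping and substitution -/

/-- The names of the variables bound in an environment. -/
def Ctx.dom (Γ : Ctx) : Set Sym := {x | ∃ B φ, Entry.bind x B φ ∈ Γ}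

/-- `Scoped X t`: the term `t` is built from the constructs that occur in function bodies (no
function terms, built-in operations or ticks), and its free variables lie in `X`. -/
inductive Scoped : Set Sym → Term → Prop
  | var {X : Set Sym} {x : Sym} : x ∈ X → Scoped X (.var x)
  | lit {X : Set Sym} (v : Val) : Scoped X (.lit v)
  | con {X : Set Sym} (c : Sym) {n : ℕ} {args : Fin n → Term} :
      (∀ i, Scoped X (args i)) → Scoped X (.con c args)
  | call {X : Set Sym} (g : Sym) {n : ℕ} {args : Fin n → Term} :
      (∀ i, Scoped X (args i)) → Scoped X (.call g args)
  | ite {X : Set Sym} {e t₁ t₂ : Term} :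
      Scoped X e → Scoped X t₁ → Scoped X t₂ → Scoped X (.ite e t₁ t₂)
  | mtch {X : Set Sym} {s : Term} {n : ℕ} {ctor : Fin n → Sym} {ar : Fin n → ℕ}
      {vars : (i : Fin n) → Fin (ar i) → Sym} {body : Fin n → Term} :
      Scoped X s → (∀ i, Scoped (X ∪ Set.range (vars i)) (body i)) →
      Scoped X (.mtch s ctor ar vars body)

theorem EnumerateE.scoped {P : Problem} {Γ : Ctx} {d : ℕ} {B : Base} {t : Term}
    (h : EnumerateE P Γ d B t) : Scoped Γ.dom t := by
  induction h with
  | var h => exact .var ⟨_, _, h⟩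
  | int n => exact .lit _
  | bool b => exact .lit _
  | con i _ ih => exact .con _ ih
  | call _ _ ih => exact .call _ ih

theorem dom_path_cons (φ : Valuation → Prop) (Γ : Ctx) : Ctx.dom (.path φ :: Γ) = Γ.dom := by
  ext x; simp [Ctx.dom]

theorem dom_bindings_append {n : ℕ} (A : Args n) (xs : Fin n → Sym) (Γ : Ctx) :
    Ctx.dom (A.bindings xs ++ Γ) = Γ.dom ∪ Set.range xs := by
  ext x
  simp only [Ctx.dom, Args.bindings, List.mem_append, List.mem_ofFn, Set.mem_ofPred_eq,
    Set.mem_union, Set.mem_range, Entry.bind.injEq]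
  constructor
  · rintro ⟨B, φ, ⟨i, rfl, -, -⟩ | h⟩
    · exact .inr ⟨i, rfl⟩
    · exact .inl ⟨B, φ, h⟩
  · rintro (⟨B, φ, h⟩ | ⟨i, rfl⟩)
    · exact ⟨B, φ, .inr h⟩
    · exact ⟨_, _, .inl ⟨i, rfl, rfl, rfl⟩⟩

theorem dom_bindings {n : ℕ} (A : Args n) (xs : Fin n → Sym) :
    Ctx.dom (A.bindings xs) = Set.range xs := by
  have h := dom_bindings_append A xs []
  have h0 : Ctx.dom [] = ∅ := by ext; simp [Ctx.dom]
  rwa [List.append_nil, h0, Set.empty_union] at h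

theorem dom_matchCtx (𝒟 : Decls) (Γ : Ctx) (φ : Refinement) (c : Sym)
    (xs : Fin (𝒟.arity c) → Sym) :
    (matchCtx 𝒟 Γ φ c xs).dom = Γ.dom ∪ Set.range xs := by
  rw [matchCtx, dom_path_cons, dom_bindings_append]

theorem GenerateI.scoped {P : Problem} {B : Base} {goal : Refinement} {d r : ℕ} {Γ : Ctx}
    {α : Ann r} {m : ℕ} {t : Term} (h : GenerateI P B goal d Γ α m t) : Scoped Γ.dom t := by
  induction h with
  | eterm h => exact h.1.scoped
  | mtch hs _ _ _ _ _ ih =>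
    exact .mtch hs.scoped fun i => by simpa only [dom_matchCtx] using ih i
  | ite he _ _ _ _ ih₁ ih₂ =>
    rw [dom_path_cons] at ih₁ ih₂
    exact .ite he.scoped ih₁ ih₂

/-- Substituting for variables that do not occur free changes nothing. -/
theorem Scoped.substV_eq_self {X : Set Sym} {t : Term} (h : Scoped X t) {σ : Sym → Term}
    (hσ : ∀ y ∈ X, σ y = .var y) : t.substV σ = t := by
  induction h generalizing σ with
  | var h => exact hσ _ h
  | lit => rfl
  | con c _ ih => simp only [Term.substV, fun i => ih i hσ]
  | call g _ ih => simp only [Term.substV, fun i => ih i hσ]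
  | ite _ _ _ ih ih₁ ih₂ => simp only [Term.substV, ih hσ, ih₁ hσ, ih₂ hσ]
  | @mtch X s n ctor ar vars body _ _ ih ih' =>
    simp only [Term.substV, ih hσ]
    congr 1
    funext i
    refine ih' i ?_
    rintro y (hy | hy)
    · simp [hide, hσ y hy]
    · simp only [hide, Set.mem_range.1 hy, if_true]

/-- Substitutions that differ only outside the free variables have the same effect, also when the
recursive function has been substituted and a second substitution `τ` supplies variables that
a first one `σ` has left in place. -/
theorem Scoped.substV_substF_substV {F : FixTerm} (hF : Scoped (Set.range F.params) F.body)
    {X : Set Sym} {t : Term} (h : Scoped X t) {σ τ σ' : Sym → Term}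
    (hσ : ∀ y ∈ X, (∃ v, σ y = .lit v ∧ σ' y = .lit v) ∨
      (σ y = .var y ∧ τ y = σ' y ∧ ((∃ v, σ' y = .lit v) ∨ σ' y = .var y))) :
    ((t.substV σ).substF F).substV τ = (t.substV σ').substF F := by
  have hb : F.body.substV (hide F.params τ) = F.body :=
    hF.substV_eq_self fun y hy => by simp only [hide, Set.mem_range.1 hy, if_true]
  induction h generalizing σ τ σ' with
  | @var X x h =>
    rcases hσ x h with ⟨v, h₁, h₂⟩ | ⟨h₁, h₂, ⟨v, h₃⟩ | h₃⟩ <;>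
      simp_all [Term.substV, Term.substF]
  | lit => rfl
  | con c _ ih => simp only [Term.substV, Term.substF, fun i => ih i hσ hb]
  | call g _ ih =>
    by_cases hg : g = F.name
    · simp only [Term.substV, Term.substF, if_pos hg, hb, fun i => ih i hσ hb]
    · simp only [Term.substV, Term.substF, if_neg hg, fun i => ih i hσ hb]
  | ite _ _ _ ih ih₁ ih₂ => simp only [Term.substV, Term.substF, ih hσ hb, ih₁ hσ hb, ih₂ hσ hb]
  | @mtch X s n ctor ar vars body _ _ ih ih' =>
    simp only [Term.substV, Term.substF, ih hσ hb]
    congr 1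
    funext i
    refine ih' i ?_ (hF.substV_eq_self fun y hy => by simp only [hide, Set.mem_range.1 hy, if_true])
    intro y hy
    by_cases hyv : ∃ j, vars i j = y
    · exact .inr (by simp [hide, hyv])
    · have hyX : y ∈ X := hy.resolve_right hyv
      simpa only [hide, hyv, if_false] using hσ y hyX

open Classical in
/-- The substitution of the values `ρ x` for the variables `x ∈ X`. -/
noncomputable def closing (X : Set Sym) (ρ : Valuation) : Sym → Term :=
  fun y => if y ∈ X then .lit (ρ y) else .var y

theorem bindVals_eq_closing {n : ℕ} {xs : Fin n → Sym} {vs : Fin n → Val}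
    {ρ : Valuation} (hρ : ∀ i, ρ (xs i) = vs i) :
    bindVals xs vs = closing (Set.range xs) ρ := by
  funext y
  by_cases h : ∃ i, xs i = y
  · have h' : y ∈ Set.range xs := h
    simp only [bindVals, closing, dif_pos h, if_pos h', ← hρ, h.choose_spec]
  · have h' : y ∉ Set.range xs := h
    simp only [bindVals, closing, dif_neg h, if_neg h']

/-- Entering a `match` case extends the closing substitution by the pattern variables. -/
theorem Scoped.substV_case {F : FixTerm} (hF : Scoped (Set.range F.params) F.body)
    {X : Set Sym} {n : ℕ} {xs : Fin n → Sym} {t : Term} (h : Scoped (X ∪ Set.range xs) t)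
    {ρ ρ' : Valuation} {vs : Fin n → Val} (hX : ∀ x ∈ X, x ∉ Set.range xs)
    (hρ : ∀ x ∈ X, ρ' x = ρ x)
    (hvs : ∀ i, ρ' (xs i) = vs i) :
    ((t.substV (hide xs (closing X ρ))).substF F).substV (bindVals xs vs) =
      (t.substV (closing (X ∪ Set.range xs) ρ')).substF F := by
  refine Scoped.substV_substF_substV hF h ?_
  rintro y (hy | hy)
  · have hn : ¬ ∃ i, xs i = y := hX y hy
    exact .inl ⟨ρ y, by simp [hide, hn, closing, hy], by simp [closing, hy, hρ y hy]⟩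
  · have hn : ∃ i, xs i = y := hy
    refine .inr ⟨by simp only [hide, if_pos hn], ?_, .inl ⟨ρ' y, by simp [closing, hn]⟩⟩
    rw [bindVals_eq_closing hvs]
    simp [closing, hn]

/-! ### Refinements depend only on the variables in scope -/

/-- An entry depends only on the values of the variables in `X`. -/
def Entry.DependsOn (X : Set Sym) (e : Entry) : Prop :=
  ∀ ρ ρ' : Valuation, (∀ x ∈ X, ρ x = ρ' x) → match e with
    | .bind _ _ φ => ∀ v, φ ρ v → φ ρ' v
    | .path φ => φ ρ → φ ρ'

/-- All refinements and path conditions of `Γ` mention only variables bound in `Γ`. -/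
def Ctx.Closed (Γ : Ctx) : Prop := ∀ e ∈ Γ, e.DependsOn Γ.dom

theorem Entry.DependsOn.mono {X Y : Set Sym} (hXY : X ⊆ Y) {e : Entry} (h : e.DependsOn X) :
    e.DependsOn Y :=
  fun ρ ρ' hρ => h ρ ρ' fun x hx => hρ x (hXY hx)

theorem Ctx.Closed.instance_congr {𝒟 : Decls} {Γ : Ctx} (hΓ : Γ.Closed) {ρ ρ' : Valuation}
    (hρ : ∀ x ∈ Γ.dom, ρ x = ρ' x) (h : Instance 𝒟 Γ ρ) : Instance 𝒟 Γ ρ' := by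
  intro e he
  have h₁ := h e he
  have h₂ := hΓ e he ρ ρ' hρ
  cases e with
  | bind x B φ =>
    have hx : ρ x = ρ' x := hρ x ⟨B, φ, he⟩
    exact ⟨hx ▸ h₁.1, hx ▸ h₂ _ h₁.2⟩
  | path φ => exact h₂ h₁

theorem Args.dependsOn_of_mem_bindings {n : ℕ} {A : Args n} {xs : Fin n → Sym} {e : Entry}
    (h : e ∈ A.bindings xs) : e.DependsOn (Set.range xs) := by
  obtain ⟨i, rfl⟩ := by simpa [Args.bindings] using h
  intro ρ ρ' hρ v hv
  have : (fun j => ρ' (xs j)) = fun j => ρ (xs j) := funext fun j => (hρ _ ⟨j, rfl⟩).symm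
  simpa only [this] using hv

theorem closed_bindings {n : ℕ} (A : Args n) (xs : Fin n → Sym) : Ctx.Closed (A.bindings xs) :=
  fun _ he => (dom_bindings A xs).symm ▸ Args.dependsOn_of_mem_bindings he

theorem instance_bindings_iff {𝒟 : Decls} {n : ℕ} {A : Args n} {xs : Fin n → Sym}
    {ρ : Valuation} : Instance 𝒟 (A.bindings xs) ρ ↔
      ∀ i, HasBase 𝒟 (A.base i) (ρ (xs i)) ∧ A.ref i (fun j => ρ (xs j)) (ρ (xs i)) := by
  simp [Instance, Args.bindings]

theorem Fits.congr {𝒟 : Decls} {n : ℕ} {B : Fin n → Base} {φ : Fin n → Refinement}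
    {ρ ρ' : Valuation} (hφ : ∀ i v, φ i ρ v → φ i ρ' v) {y : Fin n → Val}
    (h : Fits 𝒟 B φ ρ y) : Fits 𝒟 B φ ρ' y :=
  fun i => ⟨(h i).1, hφ i _ (h i).2⟩

theorem InferE.refinement_congr {P : Problem} {Γ : Ctx} {r : ℕ} {α : Ann r} {t : Term} {B : Base}
    {φ : Refinement} {used : Fin r → ℕ} (h : InferE P Γ α t B φ used) (hΓ : Γ.Closed)
    {ρ ρ' : Valuation} (hρ : ∀ x ∈ Γ.dom, ρ x = ρ' x) (v : Val) (hv : φ ρ v) : φ ρ' v := by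
  induction h generalizing v with
  | @var x B φ hx =>
    exact ⟨hΓ _ hx ρ ρ' hρ _ hv.1, hv.2.trans (hρ x ⟨B, φ, hx⟩)⟩
  | int | bool => exact hv
  | con i _ _ ih =>
    obtain ⟨z, hz, rfl⟩ := hv
    exact ⟨z, hz.congr ih, rfl⟩
  | app _ _ _ _ _ ih =>
    obtain ⟨z, hz, hp⟩ := hv
    exact ⟨z, hz.congr ih, hp⟩
  | recApp k _ _ _ ih =>
    obtain ⟨z, hz, hp⟩ := hv
    exact ⟨z, hz.congr ih, hp⟩

/-! ### Types and costs of evaluations -/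

/-- The maximum of `T w` for `w ≤ z`, and `T 0` if `z` is negative.  The size expressions of the
patterns are negative only for finitely many `u`, where the recurrences are not used. -/
def maxUpTo (T : ℕ → ℕ) (z : ℤ) : ℕ := (Finset.range (z.toNat + 1)).sup T

theorem le_maxUpTo {T : ℕ → ℕ} {w : ℕ} {z : ℤ} (h : (w : ℤ) ≤ z) : T w ≤ maxUpTo T z :=
  Finset.le_sup (f := T) (Finset.mem_range.2 (by omega))

theorem BoundExpr.eval_nonneg (ψ : BoundExpr) (u : ℕ) : 0 ≤ ψ.eval u := by
  unfold BoundExpr.eval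
  have := Real.log_natCast_nonneg u
  positivity

/-- The function term `fix f. λ x̄. b` for the function that is synthesized. -/
def Problem.fixTerm (P : Problem) (b : Term) : FixTerm := ⟨P.recFun, P.sig.arity, P.params, b⟩

/-- Every auxiliary function has an implementation. -/
def AuxImplemented (P : Problem) (Δ : Sym → Option FixTerm) : Prop :=
  ∀ g S, P.aux g = some S → ∃ G, Δ g = some G ∧ Implements P.decls Δ G S

/-- Evaluations of `F` on inputs in fewer than `N` steps yield results of the declared type. -/
def TypedBelow (P : Problem) (Δ : Sym → Option FixTerm) (F : FixTerm) (N : ℕ) : Prop :=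
  ∀ n < N, ∀ a v C, P.sig.IsInput P.decls a → EvalIn Δ n (F.applyTo a) v C →
    HasBase P.decls P.sig.cod v ∧ P.sig.post a v

/-- `T` bounds the resource usage of `F` on inputs, as a function of their size. -/
def UsageBound (P : Problem) (Δ : Sym → Option FixTerm) (F : FixTerm) (T : ℕ → ℕ) : Prop :=
  ∀ a v C, P.sig.IsInput P.decls a → EvalsTo Δ (F.applyTo a) v C → C ≤ T (P.sig.size a)

/-- Semantic soundness of `e : {B | φ}` over `Γ`: in every instance of `Γ`, the values of `e` have
this type, and for large inputs the resource usage is `O(ψ)`, plus that of `used k` calls of the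
recursive function on problems of size at most `α.size k u`.  The bound `N` on the number of steps
makes the type correctness of the recursive function available by induction; the constants are
independent of the instance. -/
def SoundTerm (P : Problem) (Δ : Sym → Option FixTerm) (F : FixTerm) (T : ℕ → ℕ) (Γ : Ctx) {r : ℕ}
    (α : Ann r) (e : Term) (B : Base) (φ : Refinement) (used : Fin r → ℕ) : Prop :=
  ∃ c : ℕ, ∃ M : ℝ, 0 ≤ M ∧ ∀ ρ N n v C, Instance P.decls Γ ρ → TypedBelow P Δ F N → n < N →
    EvalIn Δ n ((e.substV (closing Γ.dom ρ)).substF F) v C →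
    HasBase P.decls B v ∧ φ ρ v ∧
      (c ≤ P.topSize ρ → (C : ℝ) ≤ M * α.bound.eval (P.topSize ρ) +
        ∑ k, (used k : ℝ) * maxUpTo T (α.size k (P.topSize ρ)))

/-- Soundness of a tuple of arguments, with common constants. -/
theorem SoundTerm.args {P : Problem} {Δ : Sym → Option FixTerm} {F : FixTerm} {T : ℕ → ℕ}
    {Γ : Ctx} {r : ℕ} {α : Ann r} {m : ℕ} {args : Fin m → Term} {B : Fin m → Base}
    {φ : Fin m → Refinement} {used : Fin m → Fin r → ℕ}
    (h : ∀ j, SoundTerm P Δ F T Γ α (args j) (B j) (φ j) (used j)) :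
    ∃ c : ℕ, ∃ M : ℝ, 0 ≤ M ∧ ∀ ρ N, ∀ (ns : Fin m → ℕ) (vs : Fin m → Val) (Cs : Fin m → ℕ),
      Instance P.decls Γ ρ → TypedBelow P Δ F N → (∀ j, ns j < N) →
      (∀ j, EvalIn Δ (ns j) (((args j).substV (closing Γ.dom ρ)).substF F) (vs j) (Cs j)) →
      Fits P.decls B φ ρ vs ∧
        (c ≤ P.topSize ρ → ((∑ j, Cs j : ℕ) : ℝ) ≤ M * α.bound.eval (P.topSize ρ) +
          ∑ k, ((∑ j, used j) k : ℝ) * maxUpTo T (α.size k (P.topSize ρ))) := by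
  choose c M hM h using h
  refine ⟨Finset.univ.sup c, ∑ j, M j, Finset.sum_nonneg fun j _ => hM j, ?_⟩
  intro ρ N ns vs Cs hρ hN hns hev
  have h' := fun j => h j ρ N (ns j) (vs j) (Cs j) hρ hN (hns j) (hev j)
  refine ⟨fun j => ⟨(h' j).1, (h' j).2.1⟩, fun hc => ?_⟩
  have := Finset.sum_le_sum fun j (_ : j ∈ Finset.univ) =>
    (h' j).2.2 ((Finset.le_sup (f := c) (Finset.mem_univ j)).trans hc)
  rw [Finset.sum_add_distrib, ← Finset.sum_mul, Finset.sum_comm] at this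
  simpa only [Nat.cast_sum, Finset.sum_apply, Finset.sum_mul] using this

/-- The threshold in `InBigO` can be traded for an additive constant. -/
theorem InBigO.exists_le_mul_add {T : ℕ → ℕ} {ψ : BoundExpr} (h : InBigO T ψ.eval) :
    ∃ M K : ℝ, 0 ≤ M ∧ 0 ≤ K ∧ ∀ w, (T w : ℝ) ≤ M * ψ.eval w + K := by
  obtain ⟨c, M, hM, h⟩ := h
  refine ⟨M, maxUpTo T c, hM, Nat.cast_nonneg _, fun w => ?_⟩
  rcases le_total c w with hw | hw
  · exact (h w hw).trans (le_add_of_nonneg_right (Nat.cast_nonneg _))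
  · have h₁ : (T w : ℝ) ≤ maxUpTo T c := Nat.cast_le.2 (le_maxUpTo (Nat.cast_le.2 hw))
    have := mul_nonneg hM (ψ.eval_nonneg w)
    linarith

/-- The checks on an E-term are sound: the values of E-terms satisfy the inferred refinements, so
the validity queries apply to the arguments that actually occur.  Since `1 ≤ ψ` for the bound `ψ`
of the annotation, additive constants in the costs of auxiliary functions are absorbed by
`O(ψ)`. -/
theorem InferE.soundTerm {P : Problem} {Δ : Sym → Option FixTerm} {b : Term} {T : ℕ → ℕ}
    (hΔ : AuxImplemented P Δ) (hT : UsageBound P Δ (P.fixTerm b) T) {Γ : Ctx} {r : ℕ} {α : Ann r}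
    (hα : ∀ u, 1 ≤ u → 1 ≤ α.bound.eval u) {e : Term} {B : Base} {φ : Refinement}
    {used : Fin r → ℕ} (h : InferE P Γ α e B φ used) :
    SoundTerm P Δ (P.fixTerm b) T Γ α e B φ used := by
  induction h with
  | @var x B φ hx =>
    refine ⟨0, 0, le_rfl, fun ρ N n v C hρ _ _ hev => ?_⟩
    have hx' : x ∈ Γ.dom := ⟨B, φ, hx⟩
    simp only [Term.substV, closing, if_pos hx', Term.substF] at hev
    obtain ⟨rfl, rfl⟩ := hev.of_lit
    have := hρ _ hx
    exact ⟨this.1, ⟨this.2, rfl⟩, fun _ => by simp⟩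
  | int z =>
    refine ⟨0, 0, le_rfl, fun ρ N n v C hρ _ _ hev => ?_⟩
    obtain ⟨rfl, rfl⟩ := EvalIn.of_lit hev
    exact ⟨.int z, rfl, fun _ => by simp⟩
  | bool z =>
    refine ⟨0, 0, le_rfl, fun ρ N n v C hρ _ _ hev => ?_⟩
    obtain ⟨rfl, rfl⟩ := EvalIn.of_lit hev
    exact ⟨.bool z, rfl, fun _ => by simp⟩
  | @con D i args φ used _ hok ih =>
    obtain ⟨c, M, hM, h⟩ := SoundTerm.args ih
    refine ⟨c, M, hM, fun ρ N n v C hρ hN hn hev => ?_⟩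
    obtain ⟨vs, ns, Cs, rfl, hvs, hns, rfl⟩ := EvalIn.con_inv hev
    obtain ⟨hf, hc⟩ := h ρ N ns vs Cs hρ hN (fun j => (hns j).trans hn) hvs
    exact ⟨.con D i vs (fun j => (hf j).1) (hok ρ vs hρ hf), ⟨vs, hf, rfl⟩, hc⟩
  | @app g S args φ used hg hS _ hok hcost ih =>
    obtain ⟨c, M, hM, h⟩ := SoundTerm.args ih
    obtain ⟨c', M', hM', hcost⟩ := hcost
    obtain ⟨G, hG, htype, Tg, hTg, hO⟩ := hΔ g S hS
    obtain ⟨Mg, Kg, hMg, hKg, hle⟩ := hO.exists_le_mul_add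
    refine ⟨max (max c c') 1, M + (Mg * M' + Kg), by positivity,
      fun ρ N n v C hρ hN hn hev => ?_⟩
    simp only [Term.substV, Term.substF, Problem.fixTerm, if_neg hg] at hev
    obtain ⟨n₁, hn₁, hev⟩ := hev.call_inv hG
    obtain ⟨vs, ns, Cs, n', C', hvs, hns, hcall, -, rfl⟩ := hev.app_inv
    obtain ⟨hf, hc⟩ := h ρ N ns vs Cs hρ hN (fun j => ((hns j).trans hn₁).trans hn) hvs
    have hin : S.IsInput P.decls vs := fun j => ⟨(hf j).1, hok ρ vs hρ hf j⟩
    obtain ⟨hv, hp⟩ := htype vs v C' hin hcall.evalsTo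
    refine ⟨hv, ⟨vs, hf, hp⟩, fun hu => ?_⟩
    have h₁ := hc (by omega)
    have h₂ : (C' : ℝ) ≤ Tg (S.size vs) :=
      Nat.cast_le.2 ((hTg.2 _).1 ⟨vs, v, hin, rfl, hcall.evalsTo⟩)
    have h₃ := hle (S.size vs)
    have h₄ := mul_le_mul_of_nonneg_left (hcost ρ vs hρ hf (by omega)) hMg
    have h₅ := mul_le_mul_of_nonneg_left (hα (P.topSize ρ) (by omega)) hKg
    push_cast at h₁ ⊢
    linarith
  | @recApp args φ used k _ hok hsize ih =>
    obtain ⟨c, M, hM, h⟩ := SoundTerm.args ih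
    refine ⟨c, M, hM, fun ρ N n v C hρ hN hn hev => ?_⟩
    simp only [Term.substV, Term.substF, Problem.fixTerm, if_true] at hev
    obtain ⟨vs, ns, Cs, n', C', hvs, hns, hcall, hn', rfl⟩ := hev.app_inv
    obtain ⟨hf, hc⟩ := h ρ N ns vs Cs hρ hN (fun j => (hns j).trans hn) hvs
    have hin : P.sig.IsInput P.decls vs := fun j => ⟨(hf j).1, hok ρ vs hρ hf j⟩
    obtain ⟨hv, hp⟩ := hN n' (by omega) vs v C' hin hcall
    refine ⟨hv, ⟨vs, hf, hp⟩, fun hu => ?_⟩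
    have h₁ := hc hu
    have h₂ : (C' : ℝ) ≤ maxUpTo T (α.size k (P.topSize ρ)) :=
      Nat.cast_le.2 ((hT vs v C' hin hcall.evalsTo).trans (le_maxUpTo (hsize ρ vs hρ hf)))
    have h₃ : ∑ j, (((Pi.single k 1 : Fin r → ℕ) j : ℕ) : ℝ) *
        maxUpTo T (α.size j (P.topSize ρ)) = maxUpTo T (α.size k (P.topSize ρ)) := by
      rw [Finset.sum_eq_single k] <;> simp +contextual
    simp only [Pi.add_apply, Nat.cast_add, add_mul, Finset.sum_add_distrib, h₃] at h₁ ⊢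
    linarith

/-- Costs add up along the evaluation of a scrutinee or guard and the branch taken after it. -/
theorem add_le_of_updateCost {r : ℕ} {α : Ann r} {used : Fin r → ℕ} (hused : ∀ k, used k ≤ α.cost k)
    {g : Fin r → ℝ} {C₁ C₂ M₁ M₂ x : ℝ} (h₁ : C₁ ≤ M₁ * x + ∑ k, (used k : ℝ) * g k)
    (h₂ : C₂ ≤ M₂ * x + ∑ k, ((α.updateCost used).cost k : ℝ) * g k) :
    C₁ + C₂ ≤ (M₁ + M₂) * x + ∑ k, (α.cost k : ℝ) * g k := by
  have : ∑ k, (α.cost k : ℝ) * g k = ∑ k, (used k : ℝ) * g k +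
      ∑ k, ((α.updateCost used).cost k : ℝ) * g k := by
    rw [← Finset.sum_add_distrib]
    refine Finset.sum_congr rfl fun k _ => ?_
    rw [Ann.updateCost, Nat.cast_sub (hused k)]
    ring
  linarith

theorem HasBase.con_args {𝒟 : Decls} {D c : Sym} {vs : Fin (𝒟.arity c) → Val}
    (h : HasBase 𝒟 (.data D) (.con c vs)) (j : Fin (𝒟.arity c)) :
    HasBase 𝒟 ((𝒟.args c).base j) (vs j) ∧ (𝒟.args c).ref j vs (vs j) := by
  generalize hv : Val.con c vs = v at h
  cases h with
  | con _ i vs' h₁ h₂ =>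
    simp only [Val.con.injEq] at hv
    obtain ⟨rfl, -, hv⟩ := hv
    obtain rfl := eq_of_heq hv
    exact ⟨h₁ j, h₂ j⟩

theorem closed_path_cons {Γ : Ctx} (hΓ : Γ.Closed) {φ : Valuation → Prop}
    (hφ : ∀ ρ ρ' : Valuation, (∀ x ∈ Γ.dom, ρ x = ρ' x) → φ ρ → φ ρ') :
    Ctx.Closed (.path φ :: Γ) := by
  intro e he
  rw [dom_path_cons]
  rcases List.mem_cons.1 he with rfl | he
  · exact hφ
  · exact hΓ e he

theorem closed_matchCtx {P : Problem} {Γ : Ctx} (hΓ : Γ.Closed) {r : ℕ} {α : Ann r} {s : Term}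
    {B : Base} {φ : Refinement} {used : Fin r → ℕ} (h : InferE P Γ α s B φ used) {c : Sym}
    {xs : Fin (P.decls.arity c) → Sym} : (matchCtx P.decls Γ φ c xs).Closed := by
  refine closed_path_cons ?_ ?_
  · intro e he
    rw [dom_bindings_append]
    rcases List.mem_append.1 he with he | he
    · exact (Args.dependsOn_of_mem_bindings he).mono Set.subset_union_right
    · exact (hΓ e he).mono Set.subset_union_left
  · intro ρ ρ' hρ hφ
    rw [dom_bindings_append] at hρ
    have hxs : (fun j => ρ' (xs j)) = fun j => ρ (xs j) :=
      funext fun j => (hρ _ (.inr ⟨j, rfl⟩)).symm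
    rw [hxs]
    exact h.refinement_congr hΓ (fun x hx => hρ x (.inl hx)) _ hφ

theorem exists_valuation_extending {n : ℕ} {xs : Fin n → Sym} (hxs : Function.Injective xs)
    (ρ : Valuation) (vs : Fin n → Val) :
    ∃ ρ' : Valuation, (∀ i, ρ' (xs i) = vs i) ∧ ∀ x ∉ Set.range xs, ρ' x = ρ x :=
  ⟨Function.extend xs vs ρ, fun i => hxs.extend_apply _ _ i,
    fun _ hx => Function.extend_apply' _ _ _ fun h => hx h⟩

/-- Terms returned by `GenerateI` are sound for the goal and the costs allowed by the annotation. -/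
theorem GenerateI.soundTerm {P : Problem} {Δ : Sym → Option FixTerm} {b : Term} {T : ℕ → ℕ}
    (hΔ : AuxImplemented P Δ) (hT : UsageBound P Δ (P.fixTerm b) T)
    (hb : Scoped (Set.range P.params) b) {B : Base} {goal : Refinement}
    (hgoal : ∀ ρ ρ' : Valuation, (∀ i, ρ (P.params i) = ρ' (P.params i)) → ∀ v,
      goal ρ v → goal ρ' v)
    {d r : ℕ} {Γ : Ctx} {α : Ann r} {m : ℕ} {t : Term} (h : GenerateI P B goal d Γ α m t)
    (hα : ∀ u, 1 ≤ u → 1 ≤ α.bound.eval u) (hΓ : Γ.Closed) (hP : ∀ i, P.params i ∈ Γ.dom) :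
    SoundTerm P Δ (P.fixTerm b) T Γ α t B goal α.cost := by
  induction h with
  | eterm h =>
    obtain ⟨-, φ, used, hi, hused, hsub⟩ := h
    obtain ⟨c, M, hM, h⟩ := hi.soundTerm hΔ hT hα
    refine ⟨c, M, hM, fun ρ N n v C hρ hN hn hev => ?_⟩
    obtain ⟨hv, hφ, hc⟩ := h ρ N n v C hρ hN hn hev
    refine ⟨hv, hsub ρ v hρ hv hφ, fun hu => (hc hu).trans ?_⟩
    gcongr with k
    exact hused k
  | @mtch Γ α m D s φ used vars body _ hi hused hinj hfresh hgen ih =>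
    obtain ⟨c₀, M₀, hM₀, hs⟩ := hi.soundTerm hΔ hT hα
    have ih' := fun i => ih i hα (closed_matchCtx hΓ hi)
      (fun j => (dom_matchCtx ..).symm ▸ Or.inl (hP j))
    choose c M hM hbody using ih'
    refine ⟨max c₀ (Finset.univ.sup c), M₀ + ∑ i, M i,
      add_nonneg hM₀ (Finset.sum_nonneg fun i _ => hM i), fun ρ N n v C hρ hN hn hev => ?_⟩
    obtain ⟨i, vs, n₁, n₂, C₁, C₂, h₁, h₂, hn₁, hn₂, rfl⟩ := EvalIn.mtch_inv hev
    obtain ⟨hsv, hsφ, hsc⟩ := hs ρ N n₁ _ C₁ hρ hN (hn₁.trans hn) h₁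
    obtain ⟨ρ', hvs, hρ'⟩ := exists_valuation_extending (hinj i) ρ vs
    have hdisj : ∀ x ∈ Γ.dom, x ∉ Set.range (vars i) := by
      rintro _ ⟨B', φ', hx⟩ ⟨j, rfl⟩
      exact hfresh i j B' φ' hx
    have hagree : ∀ x ∈ Γ.dom, ρ x = ρ' x := fun x hx => (hρ' x (hdisj x hx)).symm
    have hvs' : (fun j => ρ' (vars i j)) = vs := funext hvs
    have hinst : Instance P.decls (matchCtx P.decls Γ φ (P.decls.ctor D i) (vars i)) ρ' := by
      intro e he
      rcases List.mem_cons.1 he with rfl | he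
      · simpa only [hvs'] using hi.refinement_congr hΓ hagree _ hsφ
      rcases List.mem_append.1 he with he | he
      · refine instance_bindings_iff.2 (fun j => ?_) e he
        rw [hvs', hvs j]
        exact hsv.con_args j
      · exact hΓ.instance_congr hagree hρ e he
    have hscope := (hgen i).scoped
    rw [dom_matchCtx] at hscope
    rw [Scoped.substV_case (F := P.fixTerm b) hb hscope hdisj (fun x hx => (hagree x hx).symm) hvs,
      ← dom_matchCtx P.decls Γ φ] at h₂
    obtain ⟨hv, hg, hc⟩ := hbody i ρ' N n₂ v C₂ hinst hN (hn₂.trans hn) h₂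
    have hparams : ∀ j, ρ' (P.params j) = ρ (P.params j) := fun j => (hagree _ (hP j)).symm
    have htop : P.topSize ρ' = P.topSize ρ := by simp only [Problem.topSize, hparams]
    refine ⟨hv, hgoal ρ' ρ hparams v hg, fun hu => ?_⟩
    rw [htop] at hc
    have hci := hc
      (((Finset.le_sup (f := c) (Finset.mem_univ i)).trans (le_max_right _ _)).trans hu)
    rw [Nat.cast_add]
    refine add_le_of_updateCost hused (hsc ((le_max_left _ _).trans hu)) (hci.trans ?_)
    have hMi : M i ≤ ∑ i, M i := Finset.single_le_sum (fun i _ => hM i) (Finset.mem_univ i)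
    have := mul_le_mul_of_nonneg_right hMi (α.bound.eval_nonneg (P.topSize ρ))
    simp only [Ann.updateCost]
    linarith
  | @ite Γ α m e t₁ t₂ φ used _ hi hused hg₁ hg₂ ih₁ ih₂ =>
    obtain ⟨c₀, M₀, hM₀, hs⟩ := hi.soundTerm hΔ hT hα
    have hcl : ∀ w, Ctx.Closed (.path (fun ρ => φ ρ w) :: Γ) := fun w =>
      closed_path_cons hΓ fun ρ ρ' hρ => hi.refinement_congr hΓ hρ w
    obtain ⟨c₁, M₁, hM₁, h₁⟩ := ih₁ hα (hcl _) (by simpa only [dom_path_cons] using hP)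
    obtain ⟨c₂, M₂, hM₂, h₂⟩ := ih₂ hα (hcl _) (by simpa only [dom_path_cons] using hP)
    rw [dom_path_cons] at h₁ h₂
    refine ⟨max c₀ (max c₁ c₂), M₀ + (M₁ + M₂), by positivity, fun ρ N n v C hρ hN hn hev => ?_⟩
    have hinst : ∀ w, φ ρ w → Instance P.decls (.path (fun ρ => φ ρ w) :: Γ) ρ := by
      intro w hw e he
      rcases List.mem_cons.1 he with rfl | he
      · exact hw
      · exact hρ e he
    have hnn := α.bound.eval_nonneg (P.topSize ρ)
    obtain ⟨z, n₁, n₂, C₁, C₂, he, hev, hn₁, hn₂, rfl⟩ := EvalIn.ite_inv hev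
    obtain ⟨-, hsφ, hsc⟩ := hs ρ N n₁ _ C₁ hρ hN (hn₁.trans hn) he
    cases z with
    | true =>
      obtain ⟨hv, hg, hc⟩ := h₁ ρ N n₂ v C₂ (hinst _ hsφ) hN (hn₂.trans hn) (by simpa using hev)
      refine ⟨hv, hg, fun hu => ?_⟩
      rw [Nat.cast_add]
      refine add_le_of_updateCost hused (hsc (by omega)) ((hc (by omega)).trans ?_)
      have : 0 ≤ M₂ * α.bound.eval (P.topSize ρ) := by positivity
      simp only [Ann.updateCost]
      linarith
    | false =>
      obtain ⟨hv, hg, hc⟩ := h₂ ρ N n₂ v C₂ (hinst _ hsφ) hN (hn₂.trans hn) (by simpa using hev)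
      refine ⟨hv, hg, fun hu => ?_⟩
      rw [Nat.cast_add]
      refine add_le_of_updateCost hused (hsc (by omega)) ((hc (by omega)).trans ?_)
      have : 0 ≤ M₁ * α.bound.eval (P.topSize ρ) := by positivity
      simp only [Ann.updateCost]
      linarith

/-- The complexity function of a synthesized function satisfies the recurrence relation given by the
annotation of its body.  The type correctness of the function, on which the refinements of recursive
calls rely, is part of the proof, by induction on the number of evaluation steps. -/
theorem GenerateI.recurrence {P : Problem} {Δ : Sym → Option FixTerm} {T : ℕ → ℕ}
    (hΔ : AuxImplemented P Δ) {d r : ℕ} {α : Ann r} {m : ℕ} {t : Term}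
    (h : GenerateI P P.sig.cod (fun ρ v => P.sig.post (fun i => ρ (P.params i)) v) d
      (P.sig.args.bindings P.params) α m t)
    (hparams : Function.Injective P.params) (hα : ∀ u, 1 ≤ u → 1 ≤ α.bound.eval u)
    (hT : IsComplexity P.decls Δ (P.fixTerm t) P.sig T) :
    ∃ c : ℕ, ∃ M : ℝ, 0 ≤ M ∧ ∀ u, c ≤ u →
      (T u : ℝ) ≤ M * α.bound.eval u + ∑ k, (α.cost k : ℝ) * maxUpTo T (α.size k u) := by
  have hTb : UsageBound P Δ (P.fixTerm t) T := fun a v C ha hev =>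
    (hT.2 _).1 ⟨a, v, ha, rfl, hev⟩
  have hscope := h.scoped
  rw [dom_bindings] at hscope
  obtain ⟨c, M, hM, hs⟩ := h.soundTerm hΔ hTb hscope
    (fun ρ ρ' hρ v hv => by simpa only [hρ] using hv) hα (closed_bindings _ _)
    (fun i => by rw [dom_bindings]; exact ⟨i, rfl⟩)
  have hbody : ∀ a, P.sig.IsInput P.decls a →
      ∀ N n v C, TypedBelow P Δ (P.fixTerm t) N → n ≤ N →
        EvalIn Δ n ((P.fixTerm t).applyTo a) v C →
        HasBase P.decls P.sig.cod v ∧ P.sig.post a v ∧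
          (c ≤ P.sig.size a → (C : ℝ) ≤ M * α.bound.eval (P.sig.size a) +
            ∑ k, (α.cost k : ℝ) * maxUpTo T (α.size k (P.sig.size a))) := by
    intro a ha N n v C hN hn hev
    obtain ⟨ρ, hρ, -⟩ := exists_valuation_extending hparams (fun _ => .int 0) a
    obtain ⟨n', hn', hev⟩ := EvalIn.app_lit_inv hev
    have hinst : Instance P.decls (P.sig.args.bindings P.params) ρ :=
      instance_bindings_iff.2 (by simpa only [hρ] using (show ∀ _, _ from ha))
    have hclose : bindVals (P.fixTerm t).params a =
        closing (Ctx.dom (P.sig.args.bindings P.params)) ρ := by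
      rw [dom_bindings]
      exact bindVals_eq_closing hρ
    rw [hclose] at hev
    simpa only [Problem.topSize, hρ] using hs ρ N n' v C hinst hN (hn'.trans_le hn) hev
  -- The call itself takes a step, so recursive calls in the body are evaluated in fewer steps.
  have htyped : ∀ N, TypedBelow P Δ (P.fixTerm t) N := by
    intro N
    induction N with
    | zero => exact fun n hn => (Nat.not_lt_zero n hn).elim
    | succ N ih =>
      intro n hn a v C ha hev
      have := hbody a ha N n v C ih (by omega) hev
      exact ⟨this.1, this.2.1⟩
  refine ⟨c, M, hM, fun u hu => ?_⟩
  -- The supremum is taken in `ℕ`, so the real bound is rounded down.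
  have hnn : 0 ≤ M * α.bound.eval u + ∑ k, (α.cost k : ℝ) * maxUpTo T (α.size k u) := by
    have := α.bound.eval_nonneg u
    positivity
  refine (Nat.cast_le.2 ((hT.2 u).2 ?_)).trans (Nat.floor_le hnn)
  rintro C ⟨a, v, ha, rfl, hev⟩
  obtain ⟨n, hev⟩ := hev.exists_evalIn
  exact Nat.le_floor ((hbody a ha n n v C (htyped n) le_rfl hev).2.2 hu)

/-! ### Solving the recurrences -/

theorem maxUpTo_le {T : ℕ → ℕ} {v : ℕ} {x : ℝ} (h : ∀ w ≤ v, (T w : ℝ) ≤ x) :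
    (maxUpTo T v : ℝ) ≤ x := by
  obtain ⟨w, hw, h'⟩ := Finset.exists_mem_eq_sup (Finset.range (v + 1)) ⟨0, by simp⟩ T
  rw [maxUpTo, Int.toNat_natCast, h']
  exact h w (by simpa [Nat.lt_succ_iff] using hw)

/-- Induction principle for recurrences on the running maximum of `T`: beyond a threshold `N`, the
bound `f` may be assumed for smaller problem sizes.  Only positive sizes are considered, so
that `f` need not dominate `T 0` at `0`. -/
theorem le_of_recurrence {T : ℕ → ℕ} {f : ℕ → ℝ} (N : ℕ)
    (hf : ∀ u v, 1 ≤ u → u ≤ v → f u ≤ f v) (hN : (maxUpTo T N : ℝ) ≤ f 1)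
    (hstep : ∀ u, N < u → (∀ v : ℕ, 1 ≤ v → v < u → (maxUpTo T v : ℝ) ≤ f v) → (T u : ℝ) ≤ f u)
    (u : ℕ) (hu : 1 ≤ u) : (T u : ℝ) ≤ f u := by
  suffices ∀ v : ℕ, 1 ≤ v → (maxUpTo T v : ℝ) ≤ f v from
    (Nat.cast_le.2 (le_maxUpTo le_rfl)).trans (this u hu)
  intro v
  induction v using Nat.strong_induction_on with
  | _ v ih =>
    intro hv
    refine maxUpTo_le fun w hw => ?_
    rcases le_or_gt w N with hwN | hwN
    · exact (Nat.cast_le.2 (le_maxUpTo (Nat.cast_le.2 hwN))).trans (hN.trans (hf 1 v le_rfl hv))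
    · exact (hstep w hwN fun x hx hxw => ih x (by omega) hx).trans (hf w v (by omega) hw)

theorem one_le_log_div {u : ℕ} (hu : 2 ≤ u) : 1 ≤ Real.log u / Real.log 2 := by
  rw [one_le_div (Real.log_pos one_lt_two)]
  exact Real.log_le_log two_pos (by exact_mod_cast hu)

theorem natLog_le_log_div {d u : ℕ} (hd : 2 ≤ d) (hu : 1 ≤ u) :
    (Nat.log d u : ℝ) ≤ Real.log u / Real.log 2 := by
  rw [le_div_iff₀ (Real.log_pos one_lt_two), ← Real.log_pow]
  have h : 2 ^ Nat.log d u ≤ u :=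
    (Nat.pow_le_pow_left hd _).trans (Nat.pow_log_le_self d (by omega))
  exact Real.log_le_log (by positivity) (by exact_mod_cast h)

theorem clog_le_log_div {u : ℕ} (hu : 1 ≤ u) :
    (Nat.clog 2 u : ℝ) ≤ Real.log u / Real.log 2 + 1 := by
  have h : Nat.clog 2 u ≤ Nat.log 2 u + 1 :=
    Nat.clog_le_of_le_pow (Nat.lt_pow_succ_log_self one_lt_two u).le
  have h' : (Nat.clog 2 u : ℝ) ≤ Nat.log 2 u + 1 := by exact_mod_cast h
  linarith [natLog_le_log_div le_rfl hu]

theorem Pattern.one_le_eval {ψ : BoundExpr} {r : ℕ} {α : Ann r} (h : Pattern ψ α) (u : ℕ)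
    (hu : 1 ≤ u) : 1 ≤ α.bound.eval u := by
  cases h <;> simp [BoundExpr.eval, hu]

section

variable {T : ℕ → ℕ} {c : ℕ} {M : ℝ}

theorem inBigO_log_of_recurrence (hM : 0 ≤ M) {d : ℕ} (hd : 2 ≤ d)
    (h : ∀ u, c ≤ u → (T u : ℝ) ≤ M + maxUpTo T (u / d : ℕ)) :
    InBigO T fun u => Real.log u := by
  set K := (maxUpTo T (max c d : ℕ) : ℝ) with hK
  have hK0 : 0 ≤ K := Nat.cast_nonneg _
  have key := le_of_recurrence (T := T) (f := fun u => M * Nat.log d u + K) (max c d)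
    (fun u v _ huv => by
      have : (Nat.log d u : ℝ) ≤ Nat.log d v := Nat.cast_le.2 (Nat.log_mono_right huv)
      gcongr)
    (by simp [hK])
    (fun u hu ih => by
      have h₁ := h u (by omega)
      have h₂ := ih (u / d) (Nat.div_pos (by omega) (by omega))
        (Nat.div_lt_self (by omega) (by omega))
      rw [Nat.log_of_one_lt_of_le (by omega) (by omega : d ≤ u)]
      push_cast at h₁ h₂ ⊢
      linarith)
  refine ⟨2, (M + K) / Real.log 2, by positivity, fun u hu => (key u (by omega)).trans ?_⟩
  have h₁ := mul_le_mul_of_nonneg_left (natLog_le_log_div hd (by omega : 1 ≤ u)) hM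
  have h₂ := mul_le_mul_of_nonneg_left (one_le_log_div hu) hK0
  calc M * Nat.log d u + K ≤ M * (Real.log u / Real.log 2) + K * (Real.log u / Real.log 2) := by
        linarith
    _ = _ := by ring

theorem inBigO_mul_log_of_recurrence (hM : 0 ≤ M) {d : ℕ} (hd : 2 ≤ d)
    (h : ∀ u, c ≤ u → (T u : ℝ) ≤ M * u + d * maxUpTo T (u / d : ℕ)) :
    InBigO T fun u => u * Real.log u := by
  set K := (maxUpTo T (max c d : ℕ) : ℝ) with hK
  have hK0 : 0 ≤ K := Nat.cast_nonneg _
  have key := le_of_recurrence (T := T) (f := fun u => (M * Nat.log d u + K) * u) (max c d)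
    (fun u v _ huv => by
      have : (Nat.log d u : ℝ) ≤ Nat.log d v := Nat.cast_le.2 (Nat.log_mono_right huv)
      gcongr)
    (by simp [hK])
    (fun u hu ih => by
      have h₁ := h u (by omega)
      have h₂ := ih (u / d) (Nat.div_pos (by omega) (by omega))
        (Nat.div_lt_self (by omega) (by omega))
      rw [Nat.log_of_one_lt_of_le (by omega) (by omega : d ≤ u)]
      have h₃ : (d : ℝ) * (u / d : ℕ) ≤ u := by exact_mod_cast Nat.mul_div_le u d
      have h₄ : (0 : ℝ) ≤ M * Nat.log d (u / d) + K := by positivity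
      have h₅ := mul_le_mul_of_nonneg_left h₂ (Nat.cast_nonneg (α := ℝ) d)
      have h₆ := mul_le_mul_of_nonneg_left h₃ h₄
      rw [Nat.cast_add, Nat.cast_one]
      linarith)
  refine ⟨2, (M + K) / Real.log 2, by positivity, fun u hu => (key u (by omega)).trans ?_⟩
  have h₁ := mul_le_mul_of_nonneg_left (natLog_le_log_div hd (by omega : 1 ≤ u)) hM
  have h₂ := mul_le_mul_of_nonneg_left (one_le_log_div hu) hK0
  calc (M * Nat.log d u + K) * u
      ≤ (M * (Real.log u / Real.log 2) + K * (Real.log u / Real.log 2)) * u := by gcongr; linarith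
    _ = _ := by ring

theorem inBigO_mul_log_of_halves (hM : 0 ≤ M)
    (h : ∀ u, c ≤ u → (T u : ℝ) ≤
      M * u + (maxUpTo T ((u + 1) / 2 : ℕ) + maxUpTo T (u / 2 : ℕ))) :
    InBigO T fun u => u * Real.log u := by
  set K := (maxUpTo T (max c 1 : ℕ) : ℝ) with hK
  have hK0 : 0 ≤ K := Nat.cast_nonneg _
  have key := le_of_recurrence (T := T) (f := fun u => (M * Nat.clog 2 u + K) * u) (max c 1)
    (fun u v _ huv => by
      have : (Nat.clog 2 u : ℝ) ≤ Nat.clog 2 v := Nat.cast_le.2 (Nat.clog_mono_right 2 huv)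
      gcongr)
    (by simp [hK])
    (fun u hu ih => by
      have h₁ := h u (by omega)
      have h₂ := ih ((u + 1) / 2) (by omega) (by omega)
      have h₃ := ih (u / 2) (by omega) (by omega)
      rw [Nat.clog_of_two_le one_lt_two (by omega : 2 ≤ u),
        show u + 2 - 1 = u + 1 from rfl]
      have h₄ : ((Nat.clog 2 (u / 2) : ℕ) : ℝ) ≤ Nat.clog 2 ((u + 1) / 2) :=
        Nat.cast_le.2 (Nat.clog_mono_right 2 (by omega))
      have h₅ : (((u + 1) / 2 : ℕ) : ℝ) + (u / 2 : ℕ) = u := by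
        rw [← Nat.cast_add]; congr 1; omega
      have h₆ : (M * Nat.clog 2 (u / 2) + K) * (u / 2 : ℕ) ≤
          (M * Nat.clog 2 ((u + 1) / 2) + K) * (u / 2 : ℕ) := by gcongr
      rw [Nat.cast_add, Nat.cast_one]
      calc (T u : ℝ) ≤ M * u + (M * Nat.clog 2 ((u + 1) / 2) + K) *
            ((((u + 1) / 2 : ℕ) : ℝ) + (u / 2 : ℕ)) := by linarith
        _ = _ := by rw [h₅]; ring)
  refine ⟨2, (2 * M + K) / Real.log 2, by positivity, fun u hu => (key u (by omega)).trans ?_⟩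
  have h₀ := one_le_log_div hu
  have h₁ := mul_le_mul_of_nonneg_left
    ((clog_le_log_div (by omega : 1 ≤ u)).trans (add_le_add_right h₀ _)) hM
  have h₂ := mul_le_mul_of_nonneg_left h₀ hK0
  calc (M * Nat.clog 2 u + K) * u
      ≤ (2 * M * (Real.log u / Real.log 2) + K * (Real.log u / Real.log 2)) * u := by
        refine mul_le_mul_of_nonneg_right ?_ (Nat.cast_nonneg u)
        linarith
    _ = _ := by ring

theorem inBigO_id_of_recurrence (hM : 0 ≤ M) {d : ℕ} (hd : 1 ≤ d)
    (h : ∀ u, c ≤ u → (T u : ℝ) ≤ M + maxUpTo T ((u : ℤ) - d)) :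
    InBigO T fun u => (u : ℝ) := by
  set K := (maxUpTo T (max c d : ℕ) : ℝ) with hK
  have hK0 : 0 ≤ K := Nat.cast_nonneg _
  have key := le_of_recurrence (T := T) (f := fun u => M * u + K) (max c d)
    (fun u v _ huv => by gcongr)
    (by show K ≤ M * ((1 : ℕ) : ℝ) + K; simp [hM])
    (fun u hu ih => by
      have h₁ := h u (by omega)
      have h₂ := ih (u - d) (by omega) (by omega)
      rw [Nat.cast_sub (by omega : d ≤ u), Nat.cast_sub (by omega : d ≤ u)] at h₂
      have hd' : (1 : ℝ) ≤ d := by exact_mod_cast hd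
      have := mul_le_mul_of_nonneg_left hd' hM
      linarith)
  refine ⟨1, M + K, by positivity, fun u hu => (key u hu).trans ?_⟩
  have h₁ : (1 : ℝ) ≤ u := by exact_mod_cast hu
  have := mul_le_mul_of_nonneg_left h₁ hK0
  linarith

theorem inBigO_sq_of_recurrence (hM : 0 ≤ M) {d : ℕ} (hd : 1 ≤ d)
    (h : ∀ u, c ≤ u → (T u : ℝ) ≤ M * u + maxUpTo T ((u : ℤ) - d)) :
    InBigO T fun u => (u : ℝ) ^ 2 := by
  set K := (maxUpTo T (max c d : ℕ) : ℝ) with hK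
  have hK0 : 0 ≤ K := Nat.cast_nonneg _
  have key := le_of_recurrence (T := T) (f := fun u => M * u ^ 2 + K) (max c d)
    (fun u v _ huv => by gcongr)
    (by show K ≤ M * ((1 : ℕ) : ℝ) ^ 2 + K; simp [hM])
    (fun u hu ih => by
      have h₁ := h u (by omega)
      have h₂ := ih (u - d) (by omega) (by omega)
      rw [Nat.cast_sub (by omega : d ≤ u), Nat.cast_sub (by omega : d ≤ u)] at h₂
      have hd' : (1 : ℝ) ≤ d := by exact_mod_cast hd
      have hu' : (d : ℝ) ≤ u := by exact_mod_cast (by omega : d ≤ u)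
      -- `(u - d) ^ 2 + u ≤ u ^ 2` for `1 ≤ d ≤ u`
      have h₃ : (u : ℝ) + (u - d) ^ 2 ≤ u ^ 2 := by nlinarith
      have := mul_le_mul_of_nonneg_left h₃ hM
      linarith)
  refine ⟨1, M + K, by positivity, fun u hu => (key u hu).trans ?_⟩
  have h₁ : (1 : ℝ) ≤ (u : ℝ) ^ 2 := one_le_pow₀ (by exact_mod_cast hu)
  have := mul_le_mul_of_nonneg_left h₁ hK0
  linarith

end

/-- The recurrence of each pattern in the table has the solution that the table claims. -/
theorem Pattern.inBigO {ψ : BoundExpr} {r : ℕ} {α : Ann r} (h : Pattern ψ α) {T : ℕ → ℕ} {c : ℕ}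
    {M : ℝ} (hM : 0 ≤ M)
    (hT : ∀ u, c ≤ u →
      (T u : ℝ) ≤ M * α.bound.eval u + ∑ k, (α.cost k : ℝ) * maxUpTo T (α.size k u)) :
    InBigO T ψ.eval := by
  cases h with
  | log d hd =>
    convert inBigO_log_of_recurrence (c := c) hM hd fun u hu => ?_ using 1
    · funext u; simp [BoundExpr.eval]
    · simpa [BoundExpr.eval] using hT u hu
  | mulLog d hd =>
    convert inBigO_mul_log_of_recurrence (c := c) hM hd fun u hu => ?_ using 1
    · funext u; simp [BoundExpr.eval]
    · simpa [BoundExpr.eval] using hT u hu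
  | halves =>
    convert inBigO_mul_log_of_halves (c := c) hM fun u hu => ?_ using 1
    · funext u; simp [BoundExpr.eval]
    · simpa [BoundExpr.eval] using hT u hu
  | linear d hd =>
    convert inBigO_id_of_recurrence (c := c) hM hd fun u hu => ?_ using 1
    · funext u; simp [BoundExpr.eval]
    · simpa [BoundExpr.eval] using hT u hu
  | quadratic d hd =>
    convert inBigO_sq_of_recurrence (c := c) hM hd fun u hu => ?_ using 1
    · funext u; simp [BoundExpr.eval]
    · simpa [BoundExpr.eval] using hT u hu

end SynPlexity

theorem mainTheorem4
    (𝒟 : SynPlexity.Decls) (aux : SynPlexity.Sym → Option SynPlexity.FunSig)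
    (Δ : SynPlexity.Sym → Option SynPlexity.FixTerm)
    (hΔ : ∀ g S, aux g = some S → ∃ G, Δ g = some G ∧ SynPlexity.Implements 𝒟 Δ G S)
    (goal : SynPlexity.FunSig) (d m : ℕ) (F : SynPlexity.FixTerm)
    (hF : SynPlexity.Synthesizes 𝒟 aux goal d m F)
    (T : ℕ → ℕ) (hT : SynPlexity.IsComplexity 𝒟 Δ F goal T) :
    SynPlexity.InBigO T goal.bound.eval := by
  cases hF with
  | abs f xs t α hxs hα ht =>
    obtain ⟨c, M, hM, h⟩ :=
      SynPlexity.GenerateI.recurrence (P := ⟨𝒟, aux, f, goal, xs⟩) hΔ ht hxs hα.one_le_eval hT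
    exact hα.inBigO hM h
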